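/- Let $(\Omega,\mathcal A,\mathbb P)$ be a probability space. Write $\mathcal B_B(E)$ for the bounded Borel subsets of $E$. A \emph{real measure} on $E$ is a $\sigma$-additive function $\mathcal B_B(E)\to\mathbb R$, and a \emph{random measure} on $E$ is a $\sigma$-additive function $M:\mathcal B_B(E)\to L^2(\Omega,\mathcal A,\mathbb P)$ with real values for which there is a real measure $C_M$ on $E\times E$ with $C_M(A\times B)=\mathrm{Cov}(M(A),M(B))$ for all $A,B\in\mathcal B_B(E)$. For a bounded measurable $\varphi:E\to\mathbb C$ with bounded support, $\langle M,\varphi\rangle=\int\varphi\,dM$ is the $L^2$-limit of the integrals of simple functions that converge uniformly to $\varphi$ and are supported in a common bounded set. A \emph{Riemann system} of $D\in\mathcal B_B(E)$ is a sequence of finite tagged Borel partitions $(I^n_j,x^n_j)_j$ of $D$, $x_j^n\in I_j^n$, with $\max_j\mathrm{diam}(I^n_j)\to0$. For a mean-square continuous process $Z$ on $E$, the integral $\int_D Z\,dM$ is \emph{uniquely defined} if the Riemann sums $\sum_j Z(x^n_j)M(I^n_j)$ converge in $L^2$ along every Riemann system of $D$, to a limit that does not depend on the system. If $Z$ is null outside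 a bounded set, $\int_E Z\,dM$ is uniquely defined if the integrals $\int_D Z\,dM$ are, with a common value, for all $D\in\mathcal B_B(E)$ outside which $Z$ is null. \textbf{Theorem.} Let $M_1$ and $M_2$ be jointly Gaussian random measures on $\mathbb R^d$ and $\mathbb R^p$ respectively, and suppose that there is a real measure $C_{M_1,M_2}$ on $\mathbb R^d\times\mathbb R^p$ with $C_{M_1,M_2}(A\times B)=\mathrm{Cov}(M_1(A),M_2(B))$ for all $A\in\mathcal B_B(\mathbb R^d)$, $B\in\mathcal B_B(\mathbb R^p)$. Then there is a unique random measure $M_1\otimes M_2$ on $\mathbb R^d\times\mathbb R^p$ with $(M_1\otimes M_2)(A\times B)=M_1(A)M_2(B)$ for all such $A,B$, and for every continuous compactly supported $\psi:\mathbb R^d\times\mathbb R^p\to\mathbb C$ the processes $y\mapsto\int_{\mathbb R^d}\psi(x,y)\,dM_1(x)$ and $x\mapsto\int_{\mathbb R^p}\psi(x,y)\,dM_2(y)$ are mean-square continuous and null outside bounded sets, both iterated stochastic integrals below are uniquely defined (in the $L^2$ sense), and $$\int_{\mathbb R^p}\int_{\mathbb R^d}\psi(x,y)\,dM_1(x)\,dM_2(y)=\langle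 M_1\otimes M_2,\psi\rangle=\int_{\mathbb R^d}\int_{\mathbb R^p}\psi(x,y)\,dM_2(y)\,dM_1(x).$$ -/

import Mathlib

open MeasureTheory ProbabilityTheory Filter Topology
open scoped ENNReal

namespace RandomMeasures

noncomputable section

/-- The bounded Borel subsets of a space. -/
def BoundedBorel (E : Type*) [MeasurableSpace E] [PseudoMetricSpace E] : Type _ :=
  {A : Set E // MeasurableSet A ∧ Bornology.IsBounded A}

/-- The underlying set of a bounded Borel set. -/
def BoundedBorel.toSet {E : Type*} [MeasurableSpace E] [PseudoMetricSpace E]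
    (A : BoundedBorel E) : Set E :=
  A.1

/-- The product `A × B` of two bounded Borel sets. -/
def BoundedBorel.prod {E F : Type*} [MeasurableSpace E] [PseudoMetricSpace E]
    [MeasurableSpace F] [PseudoMetricSpace F] (A : BoundedBorel E) (B : BoundedBorel F) :
    BoundedBorel (E × F) :=
  ⟨A.toSet ×ˢ B.toSet, A.2.1.prod B.2.1, A.2.2.prod B.2.2⟩

/-- `σ`-additivity of a set function on the bounded Borel sets: `m (⋃ Aₙ) = ∑ m (Aₙ)` for
pairwise disjoint bounded Borel sets `Aₙ` whose union is bounded. -/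
def IsSigmaAdditive {E V : Type*} [MeasurableSpace E] [PseudoMetricSpace E]
    [AddCommMonoid V] [TopologicalSpace V] (m : BoundedBorel E → V) : Prop :=
  ∀ (A : ℕ → BoundedBorel E) (B : BoundedBorel E),
    Pairwise (fun i j => Disjoint (A i).toSet (A j).toSet) →
    (⋃ n, (A n).toSet) = B.toSet → HasSum (fun n => m (A n)) (m B)

/-- A second-order random measure whose covariance structure is determined by a (locally finite,
signed) real measure on `E × E`. -/
structure IsRandomMeasure {Ω E : Type*} [MeasurableSpace Ω] [MeasurableSpace E]
    [PseudoMetricSpace E] (P : Measure Ω) (M : BoundedBorel E → Lp ℝ 2 P) : Prop where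
  sigmaAdditive : IsSigmaAdditive M
  exists_covariance : ∃ C : BoundedBorel (E × E) → ℝ, IsSigmaAdditive C ∧
    ∀ A B : BoundedBorel E, C (A.prod B) = cov[M A, M B; P]

/-- All the vectors `(M₁ (A₁), …, M₁ (Aₙ), M₂ (B₁), …, M₂ (Bₘ))` are Gaussian. -/
def JointlyGaussian {Ω E F : Type*} [MeasurableSpace Ω] [MeasurableSpace E] [PseudoMetricSpace E]
    [MeasurableSpace F] [PseudoMetricSpace F] (P : Measure Ω)
    (M₁ : BoundedBorel E → Lp ℝ 2 P) (M₂ : BoundedBorel F → Lp ℝ 2 P) : Prop :=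
  IsGaussianProcess
    (Sum.elim (fun (A : BoundedBorel E) (ω : Ω) => M₁ A ω)
      (fun (B : BoundedBorel F) (ω : Ω) => M₂ B ω)) P

/-- The cross-covariance structure of `M₁` and `M₂` is determined by a real measure. -/
def HasCrossCovarianceMeasure {Ω E F : Type*} [MeasurableSpace Ω] [MeasurableSpace E]
    [PseudoMetricSpace E] [MeasurableSpace F] [PseudoMetricSpace F] (P : Measure Ω)
    (M₁ : BoundedBorel E → Lp ℝ 2 P) (M₂ : BoundedBorel F → Lp ℝ 2 P) : Prop :=
  ∃ C : BoundedBorel (E × F) → ℝ, IsSigmaAdditive C ∧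
    ∀ (A : BoundedBorel E) (B : BoundedBorel F), C (A.prod B) = cov[M₁ A, M₂ B; P]

/-- `T` is a tensor product of `M₁` and `M₂`: a random measure on the product space with
`T (A × B) = M₁ (A) M₂ (B)` almost surely. -/
structure IsTensorRandomMeasure {Ω E F : Type*} [MeasurableSpace Ω] [MeasurableSpace E]
    [PseudoMetricSpace E] [MeasurableSpace F] [PseudoMetricSpace F] (P : Measure Ω)
    (M₁ : BoundedBorel E → Lp ℝ 2 P) (M₂ : BoundedBorel F → Lp ℝ 2 P)
    (T : BoundedBorel (E × F) → Lp ℝ 2 P) : Prop where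
  isRandomMeasure : IsRandomMeasure P T
  apply_prod : ∀ (A : BoundedBorel E) (B : BoundedBorel F),
    ∀ᵐ ω ∂P, T (A.prod B) ω = M₁ A ω * M₂ B ω

/-! ### Integration of a deterministic function against a random measure -/

/-- A simple function `∑ᵢ cᵢ 𝟙_{Aᵢ}`, with complex `cᵢ` and bounded Borel sets `Aᵢ`. -/
structure SimpleFn (E : Type*) [MeasurableSpace E] [PseudoMetricSpace E] where
  size : ℕ
  coeff : Fin size → ℂ
  set : Fin size → BoundedBorel E

/-- The values of a simple function. -/
def SimpleFn.eval {E : Type*} [MeasurableSpace E] [PseudoMetricSpace E]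
    (s : SimpleFn E) (x : E) : ℂ :=
  ∑ i, (s.set i).toSet.indicator (fun _ => s.coeff i) x

/-- The integral `∑ᵢ cᵢ M (Aᵢ)` of a simple function. -/
def SimpleFn.integral {Ω E : Type*} [MeasurableSpace Ω] [MeasurableSpace E]
    [PseudoMetricSpace E] {P : Measure Ω} (s : SimpleFn E) (M : BoundedBorel E → Lp ℝ 2 P) :
    Lp ℂ 2 P :=
  ∑ i, s.coeff i • Complex.ofRealCLM.compLp (M (s.set i))

/-- The simple functions `s n` are supported in a common bounded set and converge uniformly
to `φ`. -/
def Approximates {E : Type*} [MeasurableSpace E] [PseudoMetricSpace E]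
    (s : ℕ → SimpleFn E) (φ : E → ℂ) : Prop :=
  (∃ D : BoundedBorel E, ∀ n i, ((s n).set i).toSet ⊆ D.toSet) ∧
    TendstoUniformly (fun n => (s n).eval) φ atTop

/-- `⟨M, φ⟩ = ∫ φ dM` exists and equals `X`, as the integral of a bounded measurable function `φ`
with bounded support against an `L²`-valued measure: `φ` is the uniform limit of simple functions
supported in a common bounded set, and the integrals of any such sequence converge to `X`
in `L²`. -/
structure HasIntegral {Ω E : Type*} [MeasurableSpace Ω] [MeasurableSpace E]
    [PseudoMetricSpace E] {P : Measure Ω} (M : BoundedBorel E → Lp ℝ 2 P) (φ : E → ℂ)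
    (X : Lp ℂ 2 P) : Prop where
  exists_approx : ∃ s : ℕ → SimpleFn E, Approximates s φ
  tendsto : ∀ s : ℕ → SimpleFn E, Approximates s φ →
    Tendsto (fun n => (s n).integral M) atTop (𝓝 X)

/-! ### Integration of a process against a random measure -/

/-- A Riemann system of `D`: a sequence of finite tagged Borel partitions of `D` whose meshes tend
to `0`. When `D` is infinite, the number of cells then tends to infinity; a finite `D`, whose
finite partitions have boundedly many nonempty cells, is not excluded. -/
structure RiemannSystem {E : Type*} [MeasurableSpace E] [PseudoMetricSpace E]
    (D : BoundedBorel E) where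
  size : ℕ → ℕ
  cell : (n : ℕ) → Fin (size n) → BoundedBorel E
  tag : (n : ℕ) → Fin (size n) → E
  disjoint : ∀ n, Pairwise (fun i j => Disjoint (cell n i).toSet (cell n j).toSet)
  iUnion_eq : ∀ n, (⋃ j, (cell n j).toSet) = D.toSet
  tag_mem : ∀ n j, tag n j ∈ (cell n j).toSet
  mesh_tendsto : Tendsto (fun n => ⨆ j, Metric.ediam (cell n j).toSet) atTop (𝓝 0)

/-- The Riemann sum `∑ⱼ Z (xⱼⁿ) M (Iⱼⁿ)`. -/
def RiemannSystem.sum {Ω E : Type*} [MeasurableSpace Ω] [MeasurableSpace E]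
    [PseudoMetricSpace E] {P : Measure Ω} {D : BoundedBorel E} (R : RiemannSystem D)
    (Z : E → Lp ℂ 2 P) (M : BoundedBorel E → Lp ℝ 2 P) (n : ℕ) (ω : Ω) : ℂ :=
  ∑ j, Z (R.tag n j) ω * (M (R.cell n j) ω : ℂ)

/-- The stochastic integral `∫_D Z dM` is uniquely defined in the `L²` sense, with value `X`:
Riemann systems of `D` exist, and the Riemann sums along each of them converge to `X`
in `L²`. -/
structure HasStochIntegralOn {Ω E : Type*} [MeasurableSpace Ω] [MeasurableSpace E]
    [PseudoMetricSpace E] {P : Measure Ω} (Z : E → Lp ℂ 2 P) (M : BoundedBorel E → Lp ℝ 2 P)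
    (D : BoundedBorel E) (X : Lp ℂ 2 P) : Prop where
  nonempty : Nonempty (RiemannSystem D)
  tendsto : ∀ R : RiemannSystem D,
    Tendsto (fun n => eLpNorm (fun ω => R.sum Z M n ω - X ω) 2 P) atTop (𝓝 0)

/-- The stochastic integral `∫ Z dM` over the whole space, of a mean-square continuous process `Z`
which is null outside a bounded set, is uniquely defined in the `L²` sense, with value `X`:
for every bounded Borel `D` outside which `Z` is null, `∫_D Z dM` is, with that value. -/
structure HasStochIntegral {Ω E : Type*} [MeasurableSpace Ω] [MeasurableSpace E]
    [PseudoMetricSpace E] {P : Measure Ω} (Z : E → Lp ℂ 2 P) (M : BoundedBorel E → Lp ℝ 2 P)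
    (X : Lp ℂ 2 P) : Prop where
  continuous : ∀ x₀ : E, Tendsto Z (𝓝 x₀) (𝓝 (Z x₀))
  exists_null_outside : ∃ D : BoundedBorel E, ∀ x ∉ D.toSet, Z x = 0
  hasStochIntegralOn : ∀ D : BoundedBorel E, (∀ x ∉ D.toSet, Z x = 0) →
    HasStochIntegralOn Z M D X

/-! ### The integrals are determined by the definitions -/

theorem HasIntegral.unique {Ω E : Type*} [MeasurableSpace Ω] [MeasurableSpace E]
    [PseudoMetricSpace E] {P : Measure Ω} {M : BoundedBorel E → Lp ℝ 2 P} {φ : E → ℂ}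
    {X Y : Lp ℂ 2 P} (hX : HasIntegral M φ X) (hY : HasIntegral M φ Y) : X = Y := by
  obtain ⟨s, hs⟩ := hX.exists_approx
  exact tendsto_nhds_unique (hX.tendsto s hs) (hY.tendsto s hs)

theorem HasStochIntegralOn.unique {Ω E : Type*} [MeasurableSpace Ω] [MeasurableSpace E]
    [PseudoMetricSpace E] {P : Measure Ω} {Z : E → Lp ℂ 2 P} {M : BoundedBorel E → Lp ℝ 2 P}
    {D : BoundedBorel E} {X Y : Lp ℂ 2 P} (hX : HasStochIntegralOn Z M D X)
    (hY : HasStochIntegralOn Z M D Y) : X = Y := by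
  obtain ⟨R⟩ := hX.nonempty
  have hmeas : ∀ n, AEStronglyMeasurable (R.sum Z M n) P := by
    intro n
    refine Finset.aestronglyMeasurable_fun_sum _ fun j _ => ?_
    exact (Lp.aestronglyMeasurable _).mul
      (Complex.continuous_ofReal.comp_aestronglyMeasurable (Lp.aestronglyMeasurable _))
  have hle : ∀ n, eLpNorm (X - Y : Lp ℂ 2 P) 2 P ≤
      eLpNorm (fun ω => R.sum Z M n ω - Y ω) 2 P
        + eLpNorm (fun ω => R.sum Z M n ω - X ω) 2 P := by
    intro n
    have h : eLpNorm (X - Y : Lp ℂ 2 P) 2 P =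
        eLpNorm ((fun ω => R.sum Z M n ω - Y ω) - (fun ω => R.sum Z M n ω - X ω)) 2 P := by
      refine eLpNorm_congr_ae ?_
      filter_upwards [Lp.coeFn_sub X Y] with ω hω
      rw [hω]
      simp
    rw [h]
    exact eLpNorm_sub_le ((hmeas n).sub (Lp.aestronglyMeasurable _))
      ((hmeas n).sub (Lp.aestronglyMeasurable _)) (by norm_num)
  have h0 : eLpNorm (X - Y : Lp ℂ 2 P) 2 P ≤ 0 := by
    have := (hY.tendsto R).add (hX.tendsto R)
    rw [add_zero] at this
    exact ge_of_tendsto' this hle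
  have h1 : X - Y = 0 := by
    rw [← norm_eq_zero, Lp.norm_def, nonpos_iff_eq_zero.mp h0, ENNReal.toReal_zero]
  exact sub_eq_zero.mp h1

theorem HasStochIntegral.unique {Ω E : Type*} [MeasurableSpace Ω] [MeasurableSpace E]
    [PseudoMetricSpace E] {P : Measure Ω} {Z : E → Lp ℂ 2 P} {M : BoundedBorel E → Lp ℝ 2 P}
    {X Y : Lp ℂ 2 P} (hX : HasStochIntegral Z M X) (hY : HasStochIntegral Z M Y) : X = Y := by
  obtain ⟨D, hD⟩ := hX.exists_null_outside
  exact (hX.hasStochIntegralOn D hD).unique (hY.hasStochIntegralOn D hD)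

end

end RandomMeasures

open RandomMeasures

/-! By Isserlis' formula the mixed moment `E[M₁(A) M₂(B) M₁(A') M₂(B')]` is a polynomial in the
means and the second moments of `M₁` and `M₂`, so it is the value at `(A × B) × (A' × B')` of a real
measure `G` on `(E × F) × (E × F)`. Thus the Gram matrix of the products `M₁(A) M₂(B)` is given by
`G`. On a bounded set the quadratic form of a real measure on `S × S` is dominated by the square of
the `L²(ν)` norm, where `ν` is the sum of the marginals of its total variation; so
`𝟙_{A × B} ↦ M₁(A) M₂(B)` extends to a continuous linear map on `L²(ν)`, whose values on indicators
form `M₁ ⊗ M₂`.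

The same domination bounds the integral of a simple function by a multiple of its supremum norm on
each bounded set, hence integration is continuous under uniform convergence. The Riemann sums of
`y ↦ ∫ ψ(x, y) dM₁(x)` against `M₂` are the integrals against `M₁ ⊗ M₂` of the functions obtained
from `ψ` by freezing `y` at the tag of its cell, and these converge uniformly to `ψ` as the mesh
tends to `0`. -/

namespace RandomMeasures

noncomputable section

/-! ### Set functions on the bounded Borel sets -/

section BoundedBorel

variable {E F : Type*} [MeasurableSpace E] [PseudoMetricSpace E] [MeasurableSpace F]
  [PseudoMetricSpace F]

namespace BoundedBorel

theorem ext {A B : BoundedBorel E} (h : A.toSet = B.toSet) : A = B :=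
  Subtype.ext h

theorem measurableSet (A : BoundedBorel E) : MeasurableSet A.toSet := A.2.1

theorem isBounded (A : BoundedBorel E) : Bornology.IsBounded A.toSet := A.2.2

/-- The part of a measurable set that lies in a bounded Borel set. -/
def trace (D : BoundedBorel E) (U : Set E) (hU : MeasurableSet U) : BoundedBorel E :=
  ⟨U ∩ D.toSet, hU.inter D.measurableSet, D.isBounded.subset Set.inter_subset_right⟩

/-- The intersection of two bounded Borel sets. -/
def inter (A D : BoundedBorel E) : BoundedBorel E := D.trace A.toSet A.measurableSet

/-- The union of two bounded Borel sets. -/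
def union (A D : BoundedBorel E) : BoundedBorel E :=
  ⟨A.toSet ∪ D.toSet, A.measurableSet.union D.measurableSet, A.isBounded.union D.isBounded⟩

/-- The preimage of a bounded Borel set under a measurable antilipschitz map. -/
def preimage {K : NNReal} (g : E → F) (hg : Measurable g) (hK : AntilipschitzWith K g)
    (U : BoundedBorel F) : BoundedBorel E :=
  ⟨g ⁻¹' U.toSet, hg U.measurableSet, hK.isBounded_preimage U.isBounded⟩

/-- The closure of a bounded set. -/
def closure [OpensMeasurableSpace E] (S : Set E) (hS : Bornology.IsBounded S) : BoundedBorel E :=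
  ⟨_root_.closure S, isClosed_closure.measurableSet, hS.closure⟩

@[simp] theorem toSet_trace (D : BoundedBorel E) (U : Set E) (hU : MeasurableSet U) :
    (D.trace U hU).toSet = U ∩ D.toSet := rfl

@[simp] theorem toSet_preimage {K : NNReal} (g : E → F) (hg : Measurable g)
    (hK : AntilipschitzWith K g) (U : BoundedBorel F) :
    (U.preimage g hg hK).toSet = g ⁻¹' U.toSet := rfl

@[simp] theorem toSet_prod (A : BoundedBorel E) (B : BoundedBorel F) :
    (A.prod B).toSet = A.toSet ×ˢ B.toSet := rfl

theorem inter_eq_left {A D : BoundedBorel E} (h : A.toSet ⊆ D.toSet) : A.inter D = A :=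
  ext (Set.inter_eq_left.mpr h)

theorem subset_closure [OpensMeasurableSpace E] {S : Set E} (hS : Bornology.IsBounded S) :
    S ⊆ (closure S hS).toSet :=
  _root_.subset_closure

theorem exists_subset_prod [OpensMeasurableSpace E] [OpensMeasurableSpace F]
    (U : BoundedBorel (E × F)) :
    ∃ (A : BoundedBorel E) (B : BoundedBorel F), U.toSet ⊆ (A.prod B).toSet := by
  obtain ⟨h₁, h₂⟩ := Bornology.isBounded_image_fst_and_snd.mpr U.isBounded
  exact ⟨closure _ h₁, closure _ h₂, fun z hz =>
    ⟨subset_closure h₁ ⟨z, hz, rfl⟩, subset_closure h₂ ⟨z, hz, rfl⟩⟩⟩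

end BoundedBorel

/-- `f A` is the part in `U` of the preimage of `A` under `π`, for every bounded Borel set `A`.
This covers in one notion restrictions to a bounded set, sections `A ↦ A × B` and changes of
coordinates. -/
def IsPullbackOn (U : Set F) (π : F → E) (f : BoundedBorel E → BoundedBorel F) : Prop :=
  ∀ A, (f A).toSet = U ∩ π ⁻¹' A.toSet

theorem isPullbackOn_trace {U : Set E} (hU : MeasurableSet U) :
    IsPullbackOn U id fun A => A.trace U hU :=
  fun _ => rfl

theorem isPullbackOn_prod_right (B : BoundedBorel F) :
    IsPullbackOn (Prod.snd ⁻¹' B.toSet) Prod.fst fun A : BoundedBorel E => A.prod B :=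
  fun _ => Set.inter_comm _ _

theorem isPullbackOn_prod_left (A : BoundedBorel E) :
    IsPullbackOn (Prod.fst ⁻¹' A.toSet) Prod.snd fun B : BoundedBorel F => A.prod B :=
  fun _ => rfl

theorem IsPullbackOn.subset {U : Set F} {π : F → E} {f : BoundedBorel E → BoundedBorel F}
    (hf : IsPullbackOn U π f) {A D : BoundedBorel E} (h : A.toSet ⊆ D.toSet) :
    (f A).toSet ⊆ (f D).toSet := by
  rw [hf, hf]
  exact Set.inter_subset_inter_right U (Set.preimage_mono h)

theorem isPullbackOn_preimage {K : NNReal} {g : E → F} (hg : Measurable g)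
    (hK : AntilipschitzWith K g) : IsPullbackOn Set.univ g (BoundedBorel.preimage g hg hK) :=
  fun _ => (Set.univ_inter _).symm

end BoundedBorel

namespace IsSigmaAdditive

variable {E F V : Type*} [MeasurableSpace E] [PseudoMetricSpace E] [MeasurableSpace F]
  [PseudoMetricSpace F]

theorem comp [AddCommMonoid V] [TopologicalSpace V] {m : BoundedBorel F → V}
    (hm : IsSigmaAdditive m) {U : Set F} {π : F → E} {f : BoundedBorel E → BoundedBorel F}
    (hf : IsPullbackOn U π f) : IsSigmaAdditive (m ∘ f) := by
  intro A B hd hB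
  refine hm _ _ (fun i j hij => ?_) ?_
  · simp only [hf _]
    exact ((hd hij).preimage π).mono Set.inter_subset_right Set.inter_subset_right
  · simp only [hf _, ← hB, ← Set.inter_iUnion, Set.preimage_iUnion]

theorem add [AddCommMonoid V] [TopologicalSpace V] [ContinuousAdd V]
    {m m' : BoundedBorel E → V} (hm : IsSigmaAdditive m) (hm' : IsSigmaAdditive m') :
    IsSigmaAdditive (m + m') :=
  fun A B hd hB => (hm A B hd hB).add (hm' A B hd hB)

theorem sub [AddCommGroup V] [TopologicalSpace V] [IsTopologicalAddGroup V]
    {m m' : BoundedBorel E → V} (hm : IsSigmaAdditive m) (hm' : IsSigmaAdditive m') :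
    IsSigmaAdditive (m - m') :=
  fun A B hd hB => (hm A B hd hB).sub (hm' A B hd hB)

theorem map {𝕜 W : Type*} [Semiring 𝕜] [AddCommMonoid V] [Module 𝕜 V] [TopologicalSpace V]
    [AddCommMonoid W] [Module 𝕜 W] [TopologicalSpace W] {m : BoundedBorel E → V}
    (hm : IsSigmaAdditive m) (L : V →L[𝕜] W) : IsSigmaAdditive (fun A => L (m A)) :=
  fun A B hd hB => (hm A B hd hB).mapL L

theorem of_vectorMeasure [AddCommMonoid V] [TopologicalSpace V] (v : VectorMeasure E V) :
    IsSigmaAdditive (fun A => v A.toSet) := fun A B hd hB => by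
  beta_reduce
  rw [← hB]
  exact v.m_iUnion (fun n => (A n).measurableSet) hd

variable [AddCommGroup V] [TopologicalSpace V] [IsTopologicalAddGroup V] [T2Space V]

theorem apply_eq_zero {m : BoundedBorel E → V} (hm : IsSigmaAdditive m)
    {A : BoundedBorel E} (hA : A.toSet = ∅) : m A = 0 := by
  have h := hm (fun _ => A) A (fun i j _ => by simp [hA]) (by simp [hA])
  exact tendsto_nhds_unique tendsto_const_nhds h.summable.tendsto_atTop_zero

open Classical in
/-- The vector measure `U ↦ m (U ∩ D)`. -/
def localize {m : BoundedBorel E → V} (hm : IsSigmaAdditive m) (D : BoundedBorel E) :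
    VectorMeasure E V where
  measureOf' U := if h : MeasurableSet U then m (D.trace U h) else 0
  empty' := by
    simp only [MeasurableSet.empty, dite_true]
    exact hm.apply_eq_zero (by simp)
  not_measurable' U hU := by simp [hU]
  m_iUnion' f hf hd := by
    simp only [hf, MeasurableSet.iUnion hf, dite_true]
    refine hm _ _ (fun i j hij => ?_) ?_
    · exact (hd hij).mono Set.inter_subset_left Set.inter_subset_left
    · simp [Set.iUnion_inter]

theorem localize_apply {m : BoundedBorel E → V} (hm : IsSigmaAdditive m) (D : BoundedBorel E)
    {U : Set E} (hU : MeasurableSet U) : hm.localize D U = m (D.trace U hU) :=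
  dif_pos hU

theorem localize_toSet {m : BoundedBorel E → V} (hm : IsSigmaAdditive m) {A D : BoundedBorel E}
    (h : A.toSet ⊆ D.toSet) : hm.localize D A.toSet = m A := by
  rw [hm.localize_apply D A.measurableSet]
  exact congrArg m (BoundedBorel.inter_eq_left h)

theorem eq_of_subset_prod {m m' : BoundedBorel (E × F) → V} (hm : IsSigmaAdditive m)
    (hm' : IsSigmaAdditive m') {A₀ : BoundedBorel E} {B₀ : BoundedBorel F}
    (h : ∀ (A : BoundedBorel E) (B : BoundedBorel F), A.toSet ⊆ A₀.toSet → B.toSet ⊆ B₀.toSet →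
      m (A.prod B) = m' (A.prod B))
    {U : BoundedBorel (E × F)} (hU : U.toSet ⊆ (A₀.prod B₀).toSet) : m U = m' U := by
  have h_rect : ∀ (A : Set E) (B : Set F), MeasurableSet A → MeasurableSet B →
      hm.localize (A₀.prod B₀) (A ×ˢ B) = hm'.localize (A₀.prod B₀) (A ×ˢ B) := by
    intro A B hA hB
    have h_trace : (A₀.prod B₀).trace (A ×ˢ B) (hA.prod hB) =
        (A₀.trace A hA).prod (B₀.trace B hB) :=
      BoundedBorel.ext Set.prod_inter_prod
    rw [hm.localize_apply _ (hA.prod hB), hm'.localize_apply _ (hA.prod hB), h_trace]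
    exact h _ _ Set.inter_subset_right Set.inter_subset_right
  have h_eq : hm.localize (A₀.prod B₀) = hm'.localize (A₀.prod B₀) := by
    refine VectorMeasure.ext_of_generateFrom _ ?_ generateFrom_prod.symm isPiSystem_prod ?_
    · rintro _ ⟨A, hA, B, hB, rfl⟩
      exact h_rect A B hA hB
    · simpa only [Set.univ_prod_univ] using h_rect _ _ MeasurableSet.univ MeasurableSet.univ
  rw [← hm.localize_toSet hU, ← hm'.localize_toSet hU, h_eq]

theorem ext_prod [OpensMeasurableSpace E] [OpensMeasurableSpace F]
    {m m' : BoundedBorel (E × F) → V} (hm : IsSigmaAdditive m) (hm' : IsSigmaAdditive m')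
    (h : ∀ (A : BoundedBorel E) (B : BoundedBorel F), m (A.prod B) = m' (A.prod B)) :
    m = m' := by
  funext U
  obtain ⟨A₀, B₀, hU⟩ := U.exists_subset_prod
  exact hm.eq_of_subset_prod hm' (fun A B _ _ => h A B) hU

end IsSigmaAdditive

/-! ### Extension from the rectangles -/

section Extension

variable {E F V : Type*} [MeasurableSpace E] [PseudoMetricSpace E] [MeasurableSpace F]
  [PseudoMetricSpace F] [AddCommGroup V] [TopologicalSpace V]

/-- The function `k` of two bounded Borel sets is the restriction to the rectangles of a
`σ`-additive set function on the product. -/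
def ExtendsToMeasure (k : BoundedBorel E → BoundedBorel F → V) : Prop :=
  ∃ m : BoundedBorel (E × F) → V, IsSigmaAdditive m ∧ ∀ A B, m (A.prod B) = k A B

theorem ExtendsToMeasure.add [IsTopologicalAddGroup V] {k l : BoundedBorel E → BoundedBorel F → V}
    (hk : ExtendsToMeasure k) (hl : ExtendsToMeasure l) : ExtendsToMeasure (k + l) := by
  obtain ⟨m, hm, hmk⟩ := hk
  obtain ⟨n, hn, hnl⟩ := hl
  exact ⟨m + n, hm.add hn, fun A B => congrArg₂ (· + ·) (hmk A B) (hnl A B)⟩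

theorem ExtendsToMeasure.sub [IsTopologicalAddGroup V] {k l : BoundedBorel E → BoundedBorel F → V}
    (hk : ExtendsToMeasure k) (hl : ExtendsToMeasure l) : ExtendsToMeasure (k - l) := by
  obtain ⟨m, hm, hmk⟩ := hk
  obtain ⟨n, hn, hnl⟩ := hl
  exact ⟨m - n, hm.sub hn, fun A B => congrArg₂ (· - ·) (hmk A B) (hnl A B)⟩

theorem extendsToMeasure_of_forall_local [IsTopologicalAddGroup V] [T2Space V]
    [OpensMeasurableSpace E] [OpensMeasurableSpace F] {k : BoundedBorel E → BoundedBorel F → V}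
    (h : ∀ (A₀ : BoundedBorel E) (B₀ : BoundedBorel F), ∃ m : BoundedBorel (E × F) → V,
      IsSigmaAdditive m ∧ ∀ A B, A.toSet ⊆ A₀.toSet → B.toSet ⊆ B₀.toSet → m (A.prod B) = k A B) :
    ExtendsToMeasure k := by
  choose m hm hmk using h
  choose A₀ B₀ hU using BoundedBorel.exists_subset_prod (E := E) (F := F)
  have h_compat : ∀ (A : BoundedBorel E) (B : BoundedBorel F) (A' : BoundedBorel E)
      (B' : BoundedBorel F) (U : BoundedBorel (E × F)), U.toSet ⊆ (A.prod B).toSet →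
      U.toSet ⊆ (A'.prod B').toSet → m A B U = m A' B' U := by
    intro A B A' B' U hAB hAB'
    refine (hm A B).eq_of_subset_prod (hm A' B') (A₀ := A.inter A') (B₀ := B.inter B')
      (fun S T hS hT => ?_) fun z hz => ⟨⟨(hAB hz).1, (hAB' hz).1⟩, (hAB hz).2, (hAB' hz).2⟩
    rw [hmk A B S T (fun x hx => (hS hx).1) fun x hx => (hT hx).1,
      hmk A' B' S T (fun x hx => (hS hx).2) fun x hx => (hT hx).2]
  refine ⟨fun U => m (A₀ U) (B₀ U) U, fun U W hd hW => ?_, fun A B => ?_⟩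
  · refine (hm _ _ U W hd hW).congr_fun fun n => ?_
    exact h_compat _ _ _ _ _ (hU _) ((hW ▸ Set.subset_iUnion _ n :).trans (hU W))
  · exact (h_compat _ _ A B _ (hU _) subset_rfl).trans (hmk A B A B subset_rfl subset_rfl)

theorem IsSigmaAdditive.extendsToMeasure_mul [OpensMeasurableSpace E] [OpensMeasurableSpace F]
    {m : BoundedBorel E → ℝ} {m' : BoundedBorel F → ℝ} (hm : IsSigmaAdditive m)
    (hm' : IsSigmaAdditive m') : ExtendsToMeasure fun A B => m A * m' B := by
  refine extendsToMeasure_of_forall_local fun A₀ B₀ => ?_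
  let s : SignedMeasure E := hm.localize A₀
  have h_fin : IsFiniteMeasure s.variation := by
    rw [← SignedMeasure.totalVariation_eq_variation]
    infer_instance
  refine ⟨_, .of_vectorMeasure (s.prod (hm'.localize B₀) (ContinuousLinearMap.mul ℝ ℝ)),
    fun A B hA hB => ?_⟩
  rw [BoundedBorel.toSet_prod, VectorMeasure.prod_apply, ContinuousLinearMap.mul_apply',
    hm.localize_toSet hA, hm'.localize_toSet hB]

end Extension

/-! ### Fourth moments of Gaussian vectors -/

section Gaussian

variable {Ω : Type*} [MeasurableSpace Ω] {P : Measure Ω}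

theorem hasDerivAt_exp_quadratic_mul {q : ℝ → ℝ} {q' : ℝ} (m v t : ℝ) (hq : HasDerivAt q q' t) :
    HasDerivAt (fun t => Real.exp (m * t + v * t ^ 2 / 2) * q t)
      (Real.exp (m * t + v * t ^ 2 / 2) * ((m + v * t) * q t + q')) t := by
  have h_exp : HasDerivAt (fun t : ℝ => Real.exp (m * t + v * t ^ 2 / 2))
      (Real.exp (m * t + v * t ^ 2 / 2) * (m + v * t)) t := by
    have h := (((hasDerivAt_id' t).const_mul m).fun_add
      ((((hasDerivAt_id' t).fun_pow 2).const_mul v).div_const 2)).exp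
    convert h using 1
    push_cast
    ring
  exact (h_exp.fun_mul hq).congr_deriv (by ring)

open scoped NNReal in
theorem integral_pow_four_gaussianReal (m : ℝ) (v : ℝ≥0) :
    ∫ x, x ^ 4 ∂(gaussianReal m v) = m ^ 4 + 6 * m ^ 2 * v + 3 * (v : ℝ) ^ 2 := by
  have h_mgf : ∫ x, x ^ 4 ∂(gaussianReal m v) =
      iteratedDeriv 4 (mgf (fun x ↦ x) (gaussianReal m v)) 0 := by
    rw [iteratedDeriv_mgf_zero] <;> simp
  have h_lin : ∀ t : ℝ, HasDerivAt (fun t : ℝ => m + v * t) (v : ℝ) t := fun t => by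
    simpa using ((hasDerivAt_id t).const_mul (v : ℝ)).const_add m
  have h₁ : deriv (fun t : ℝ => Real.exp (m * t + v * t ^ 2 / 2)) =
      fun t => Real.exp (m * t + v * t ^ 2 / 2) * (m + v * t) := funext fun t => by
    simpa using (hasDerivAt_exp_quadratic_mul m v t (hasDerivAt_const t (1 : ℝ))).deriv
  have h₂ : deriv (fun t : ℝ => Real.exp (m * t + v * t ^ 2 / 2) * (m + v * t)) =
      fun t => Real.exp (m * t + v * t ^ 2 / 2) * ((m + v * t) ^ 2 + v) := funext fun t => by
    rw [(hasDerivAt_exp_quadratic_mul m v t (h_lin t)).deriv, ← sq]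
  have h₃ : deriv (fun t : ℝ => Real.exp (m * t + v * t ^ 2 / 2) * ((m + v * t) ^ 2 + v)) =
      fun t => Real.exp (m * t + v * t ^ 2 / 2) * ((m + v * t) ^ 3 + 3 * v * (m + v * t)) :=
    funext fun t => by
      rw [(hasDerivAt_exp_quadratic_mul m v t (((h_lin t).fun_pow 2).add_const (v : ℝ))).deriv]
      push_cast
      ring
  have h₄ : deriv (fun t : ℝ => Real.exp (m * t + v * t ^ 2 / 2) *
      ((m + v * t) ^ 3 + 3 * v * (m + v * t))) 0 = m ^ 4 + 6 * m ^ 2 * v + 3 * (v : ℝ) ^ 2 := by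
    rw [(hasDerivAt_exp_quadratic_mul m v 0
      (((h_lin 0).fun_pow 3).fun_add ((h_lin 0).const_mul (3 * (v : ℝ))))).deriv]
    simp only [mul_zero, add_zero, Real.exp_zero, one_mul, zero_div, ne_eq, OfNat.ofNat_ne_zero,
      not_false_eq_true, zero_pow]
    push_cast
    ring
  rw [h_mgf, mgf_fun_id_gaussianReal]
  simp only [iteratedDeriv_succ, iteratedDeriv_zero, h₁, h₂, h₃, h₄]

theorem integral_pow_four_of_hasGaussianLaw {X : Ω → ℝ} (hX : HasGaussianLaw X P) :
    ∫ ω, X ω ^ 4 ∂P = 3 * P[X ^ 2] ^ 2 - 2 * P[X] ^ 4 := by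
  have : IsProbabilityMeasure P := hX.isProbabilityMeasure
  have h_map : ∫ ω, X ω ^ 4 ∂P = ∫ x, x ^ 4 ∂(P.map X) := by
    rw [integral_map hX.aemeasurable (by fun_prop)]
  rw [h_map, hX.map_eq_gaussianReal, integral_pow_four_gaussianReal,
    Real.coe_toNNReal _ (variance_nonneg _ _), variance_eq_sub (hX.memLp (by norm_num))]
  ring

theorem integral_sq_sum_mul {ι : Type*} [Fintype ι] {X : ι → Ω → ℝ} (hX : ∀ i, MemLp (X i) 2 P)
    (a : ι → ℝ) : ∫ ω, (∑ i, a i * X i ω) ^ 2 ∂P =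
      ∑ i, ∑ j, a i * a j * ∫ ω, X i ω * X j ω ∂P := by
  have h_int : ∀ i j, Integrable (fun ω => a i * a j * (X i ω * X j ω)) P := fun i j =>
    ((hX i).integrable_mul (hX j)).const_mul _
  have h_expand : ∀ ω, (∑ i, a i * X i ω) ^ 2 = ∑ i, ∑ j, a i * a j * (X i ω * X j ω) := by
    intro ω
    simp only [sq, Finset.sum_mul_sum, mul_mul_mul_comm]
  simp only [h_expand]
  rw [integral_finsetSum _ fun i _ => integrable_finsetSum _ fun j _ => h_int i j]
  refine Finset.sum_congr rfl fun i _ => ?_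
  rw [integral_finsetSum _ fun j _ => h_int i j]
  simp only [integral_const_mul]

theorem integral_pow_four_sum_mul {ι : Type*} [Fintype ι] {X : ι → Ω → ℝ}
    (hX : HasGaussianLaw (fun ω i => X i ω) P) (a : ι → ℝ) :
    Integrable (fun ω => (∑ i, a i * X i ω) ^ 4) P ∧
      ∫ ω, (∑ i, a i * X i ω) ^ 4 ∂P =
        3 * (∑ i, ∑ j, a i * a j * ∫ ω, X i ω * X j ω ∂P) ^ 2 -
          2 * (∑ i, a i * ∫ ω, X i ω ∂P) ^ 4 := by
  have h_sum : HasGaussianLaw (fun ω => ∑ i, a i * X i ω) P := by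
    simpa using hX.map_fun (∑ i, a i • ContinuousLinearMap.proj (R := ℝ) (φ := fun _ : ι => ℝ) i)
  constructor
  · refine ((h_sum.memLp (p := 4) (by norm_num)).integrable_norm_pow (by norm_num)).congr
      (ae_of_all _ fun ω => ?_)
    exact (show Even 4 by decide).pow_abs _
  · rw [integral_pow_four_of_hasGaussianLaw h_sum]
    simp only [Pi.pow_apply]
    rw [integral_sq_sum_mul fun i => (hX.eval i).memLp (by norm_num),
      integral_finsetSum _ fun i _ => (hX.eval i).integrable.const_mul _]
    simp only [integral_const_mul]

/-- Isserlis' formula, without the usual centring. -/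
theorem integral_mul_four_of_hasGaussianLaw {X : Fin 4 → Ω → ℝ}
    (hX : HasGaussianLaw (fun ω i => X i ω) P) :
    ∫ ω, X 0 ω * X 1 ω * (X 2 ω * X 3 ω) ∂P =
      (∫ ω, X 0 ω * X 1 ω ∂P) * (∫ ω, X 2 ω * X 3 ω ∂P) +
      (∫ ω, X 0 ω * X 2 ω ∂P) * (∫ ω, X 1 ω * X 3 ω ∂P) +
      (∫ ω, X 0 ω * X 3 ω ∂P) * (∫ ω, X 1 ω * X 2 ω ∂P) -
      2 * ((∫ ω, X 0 ω ∂P) * (∫ ω, X 1 ω ∂P) * ((∫ ω, X 2 ω ∂P) * (∫ ω, X 3 ω ∂P))) := by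
  -- The fourth powers of the signed sums of `X 0`, …, `X 3` with an even number of minus signs,
  -- minus those with an odd number, polarise `192 * (X 0 * X 1 * X 2 * X 3)`.
  let a : Fin 8 → Fin 4 → ℝ := ![![1, 1, 1, 1], ![1, 1, -1, -1], ![1, -1, 1, -1], ![1, -1, -1, 1],
    ![1, 1, 1, -1], ![1, 1, -1, 1], ![1, -1, 1, 1], ![1, -1, -1, -1]]
  let c : Fin 8 → ℝ := ![1, 1, 1, 1, -1, -1, -1, -1]
  have h_polar : ∀ ω, X 0 ω * X 1 ω * (X 2 ω * X 3 ω) =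
      ∑ l, c l / 192 * (∑ i, a l i * X i ω) ^ 4 := by
    intro ω
    simp only [a, c, Fin.sum_univ_eight, Fin.sum_univ_four, Matrix.cons_val]
    ring
  have h_symm : ∀ i j, ∫ ω, X i ω * X j ω ∂P = ∫ ω, X j ω * X i ω ∂P := fun i j => by
    simp only [mul_comm]
  simp only [h_polar]
  rw [integral_finsetSum _ fun l _ => (integral_pow_four_sum_mul hX (a l)).1.const_mul _]
  simp only [integral_const_mul, (integral_pow_four_sum_mul hX _).2]
  simp only [a, c, Fin.sum_univ_eight, Fin.sum_univ_four, Matrix.cons_val, h_symm 1 0, h_symm 2 0,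
    h_symm 3 0, h_symm 2 1, h_symm 3 1, h_symm 3 2]
  ring

end Gaussian

/-! ### Moments of random measures -/

section Moments

theorem isometry_prodProdProdComm {E E' F F' : Type*} [PseudoMetricSpace E] [PseudoMetricSpace E']
    [PseudoMetricSpace F] [PseudoMetricSpace F'] :
    Isometry (fun z : (E × E') × (F × F') => ((z.1.1, z.2.1), (z.1.2, z.2.2))) :=
  Isometry.of_dist_eq fun x y => by
    simp only [Prod.dist_eq]
    exact max_max_max_comm _ _ _ _

theorem isometry_prodSwapSnd {E E' F F' : Type*} [PseudoMetricSpace E] [PseudoMetricSpace E']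
    [PseudoMetricSpace F] [PseudoMetricSpace F'] :
    Isometry (fun z : (E × F') × (E' × F) => ((z.1.1, z.2.2), (z.2.1, z.1.2))) :=
  Isometry.of_dist_eq fun x y => by
    simp only [Prod.dist_eq]
    rw [max_max_max_comm, max_comm (dist x.2.2 y.2.2), max_max_max_comm]

section Permutation

variable {E E' F F' V : Type*} [MeasurableSpace E] [PseudoMetricSpace E] [MeasurableSpace E']
  [PseudoMetricSpace E'] [MeasurableSpace F] [PseudoMetricSpace F] [MeasurableSpace F']
  [PseudoMetricSpace F'] [AddCommMonoid V] [TopologicalSpace V]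

theorem IsSigmaAdditive.exists_prodProdProdComm {m : BoundedBorel ((E × E') × (F × F')) → V}
    (hm : IsSigmaAdditive m) : ∃ G : BoundedBorel ((E × F) × (E' × F')) → V, IsSigmaAdditive G ∧
      ∀ (A : BoundedBorel E) (B : BoundedBorel F) (A' : BoundedBorel E') (B' : BoundedBorel F'),
        G ((A.prod B).prod (A'.prod B')) = m ((A.prod A').prod (B.prod B')) := by
  refine ⟨_, hm.comp (isPullbackOn_preimage
    (g := fun z : (E × E') × (F × F') => ((z.1.1, z.2.1), (z.1.2, z.2.2))) (by fun_prop)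
    isometry_prodProdProdComm.antilipschitz), fun A B A' B' => congrArg m (BoundedBorel.ext ?_)⟩
  ext z
  exact and_and_and_comm

theorem IsSigmaAdditive.exists_prodSwapSnd {m : BoundedBorel ((E × F') × (E' × F)) → V}
    (hm : IsSigmaAdditive m) : ∃ G : BoundedBorel ((E × F) × (E' × F')) → V, IsSigmaAdditive G ∧
      ∀ (A : BoundedBorel E) (B : BoundedBorel F) (A' : BoundedBorel E') (B' : BoundedBorel F'),
        G ((A.prod B).prod (A'.prod B')) = m ((A.prod B').prod (A'.prod B)) := by
  refine ⟨_, hm.comp (isPullbackOn_preimage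
    (g := fun z : (E × F') × (E' × F) => ((z.1.1, z.2.2), (z.2.1, z.1.2))) (by fun_prop)
    isometry_prodSwapSnd.antilipschitz), fun A B A' B' => congrArg m (BoundedBorel.ext ?_)⟩
  ext z
  simp only [BoundedBorel.toSet_preimage, BoundedBorel.toSet_prod, Set.mem_preimage, Set.mem_prod]
  tauto

end Permutation

variable {Ω E F : Type*} [MeasurableSpace Ω] {P : Measure Ω} [MeasurableSpace E]
  [PseudoMetricSpace E] [MeasurableSpace F] [PseudoMetricSpace F] {M₁ : BoundedBorel E → Lp ℝ 2 P}
  {M₂ : BoundedBorel F → Lp ℝ 2 P}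

theorem inner_eq_integral_mul (X Y : Lp ℝ 2 P) : inner ℝ X Y = ∫ ω, X ω * Y ω ∂P := by
  simp only [L2.inner_def, RCLike.inner_apply, conj_trivial, mul_comm]

theorem cov_eq_inner_sub [IsProbabilityMeasure P] (X Y : Lp ℝ 2 P) :
    cov[X, Y; P] = inner ℝ X Y - (∫ ω, X ω ∂P) * ∫ ω, Y ω ∂P := by
  rw [covariance_eq_sub (Lp.memLp X) (Lp.memLp Y), inner_eq_integral_mul]
  rfl

theorem IsSigmaAdditive.integral [IsFiniteMeasure P] (hM : IsSigmaAdditive M₁) :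
    IsSigmaAdditive (fun A => ∫ ω, M₁ A ω ∂P) := by
  simpa only [innerSL_apply_apply, L2.inner_indicatorConstLp_one, setIntegral_univ] using
    hM.map (innerSL ℝ (indicatorConstLp 2 MeasurableSet.univ (measure_ne_top _ _) (1 : ℝ)))

theorem extendsToMeasure_cov_iff [IsProbabilityMeasure P] [OpensMeasurableSpace E]
    [OpensMeasurableSpace F] (hM₁ : IsSigmaAdditive M₁) (hM₂ : IsSigmaAdditive M₂) :
    ExtendsToMeasure (fun A B => cov[M₁ A, M₂ B; P]) ↔
      ExtendsToMeasure fun A B => inner ℝ (M₁ A) (M₂ B) := by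
  have h_mean := hM₁.integral.extendsToMeasure_mul hM₂.integral
  have h_cov : (fun A B => cov[M₁ A, M₂ B; P]) = (fun A B => inner ℝ (M₁ A) (M₂ B)) -
      fun A B => (∫ ω, M₁ A ω ∂P) * ∫ ω, M₂ B ω ∂P := by
    funext A B
    exact cov_eq_inner_sub _ _
  exact ⟨fun h => by simpa only [h_cov, sub_add_cancel] using h.add h_mean,
    fun h => h_cov ▸ h.sub h_mean⟩

theorem JointlyGaussian.integral_mul_four (hG : JointlyGaussian P M₁ M₂) (A : BoundedBorel E)
    (B : BoundedBorel F) (A' : BoundedBorel E) (B' : BoundedBorel F) :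
    ∫ ω, M₁ A ω * M₂ B ω * (M₁ A' ω * M₂ B' ω) ∂P =
      inner ℝ (M₁ A) (M₂ B) * inner ℝ (M₁ A') (M₂ B') +
      inner ℝ (M₁ A) (M₁ A') * inner ℝ (M₂ B) (M₂ B') +
      inner ℝ (M₁ A) (M₂ B') * inner ℝ (M₁ A') (M₂ B) -
      2 * (((∫ ω, M₁ A ω ∂P) * ∫ ω, M₂ B ω ∂P) * ((∫ ω, M₁ A' ω ∂P) * ∫ ω, M₂ B' ω ∂P)) := by
  let f : Fin 4 → BoundedBorel E ⊕ BoundedBorel F := ![.inl A, .inr B, .inl A', .inr B']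
  have h_law : HasGaussianLaw (fun ω i => Sum.elim (fun (A : BoundedBorel E) (ω : Ω) => M₁ A ω)
      (fun (B : BoundedBorel F) (ω : Ω) => M₂ B ω) (f i) ω) P :=
    ((hG.comp_right f).hasGaussianLaw Finset.univ).map_fun
      (ContinuousLinearMap.pi fun i : Fin 4 => ContinuousLinearMap.proj (R := ℝ)
        (φ := fun _ : (Finset.univ : Finset (Fin 4)) => ℝ) ⟨i, Finset.mem_univ i⟩)
  rw [real_inner_comm (M₂ B) (M₁ A')]
  simp only [inner_eq_integral_mul]
  exact integral_mul_four_of_hasGaussianLaw h_law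

theorem IsRandomMeasure.extendsToMeasure_inner [IsProbabilityMeasure P] [OpensMeasurableSpace E]
    (hM : IsRandomMeasure P M₁) : ExtendsToMeasure fun A A' => inner ℝ (M₁ A) (M₁ A') :=
  (extendsToMeasure_cov_iff hM.sigmaAdditive hM.sigmaAdditive).mp hM.exists_covariance

theorem JointlyGaussian.exists_fourthMoment [IsProbabilityMeasure P] [OpensMeasurableSpace E]
    [OpensMeasurableSpace F] [SecondCountableTopology E] [SecondCountableTopology F]
    (hG : JointlyGaussian P M₁ M₂) (hM₁ : IsRandomMeasure P M₁) (hM₂ : IsRandomMeasure P M₂)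
    (hC : HasCrossCovarianceMeasure P M₁ M₂) :
    ∃ G : BoundedBorel ((E × F) × (E × F)) → ℝ, IsSigmaAdditive G ∧ ∀ A B A' B',
      G ((A.prod B).prod (A'.prod B')) = ∫ ω, M₁ A ω * M₂ B ω * (M₁ A' ω * M₂ B' ω) ∂P := by
  obtain ⟨K₁, hK₁, h₁⟩ := hM₁.extendsToMeasure_inner
  obtain ⟨K₂, hK₂, h₂⟩ := hM₂.extendsToMeasure_inner
  obtain ⟨K, hK, h⟩ := (extendsToMeasure_cov_iff hM₁.sigmaAdditive hM₂.sigmaAdditive).mp hC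
  obtain ⟨N, hN, hN_mean⟩ :=
    hM₁.sigmaAdditive.integral.extendsToMeasure_mul hM₂.sigmaAdditive.integral
  obtain ⟨KK, hKK, h_KK⟩ := hK.extendsToMeasure_mul hK
  obtain ⟨K₁₂, hK₁₂, h_K₁₂⟩ := hK₁.extendsToMeasure_mul hK₂
  obtain ⟨NN, hNN, h_NN⟩ := hN.extendsToMeasure_mul hN
  obtain ⟨G₁₂, hG₁₂, h_G₁₂⟩ := hK₁₂.exists_prodProdProdComm
  obtain ⟨G', hG', h_G'⟩ := hKK.exists_prodSwapSnd
  refine ⟨KK + G₁₂ + G' - (NN + NN), ((hKK.add hG₁₂).add hG').sub (hNN.add hNN),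
    fun A B A' B' => ?_⟩
  rw [hG.integral_mul_four, two_mul]
  simp only [Pi.add_apply, Pi.sub_apply, h_KK, h_G₁₂, h_K₁₂, h_G', h_NN, h, h₁, h₂, hN_mean]

end Moments

/-! ### Hilbert-valued measures with a prescribed Gram matrix -/

section Gram

theorem tendsto_measure_symmDiff_biUnion {α ι : Type*} [MeasurableSpace α] [Countable ι]
    (ν : Measure α) [IsFiniteMeasure ν] {A : ι → Set α} (hA : ∀ i, MeasurableSet (A i)) :
    Tendsto (fun s : Finset ι => ν (symmDiff (⋃ i ∈ s, A i) (⋃ i, A i))) atTop (𝓝 0) := by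
  have h_anti : Antitone fun s : Finset ι => (⋃ i, A i) \ ⋃ i ∈ s, A i := fun s t hst =>
    Set.sdiff_subset_sdiff_right (Set.biUnion_subset_biUnion_left hst)
  have h_inter : ⋂ s : Finset ι, (⋃ i, A i) \ ⋃ i ∈ s, A i = ∅ := by
    rw [← Set.sdiff_iUnion, ← Set.iUnion_eq_iUnion_finset, sdiff_self]
    rfl
  have h := tendsto_measure_iInter_atTop (μ := ν) (fun s => ((MeasurableSet.iUnion hA).diff
    (s.measurableSet_biUnion fun i _ => hA i)).nullMeasurableSet) h_anti ⟨∅, measure_ne_top _ _⟩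
  rw [h_inter, measure_empty] at h
  exact h.congr fun s => by
    rw [symmDiff_of_le (Set.iUnion₂_subset fun i _ => Set.subset_iUnion A i)]
    rfl

theorem sum_indicatorConstLp_eq_biUnion {α ι H : Type*} [MeasurableSpace α]
    [NormedAddCommGroup H] (p : ℝ≥0∞) (ν : Measure α) [IsFiniteMeasure ν] {A : ι → Set α}
    (hA : ∀ i, MeasurableSet (A i)) (hd : Pairwise fun i j => Disjoint (A i) (A j)) (c : H)
    (s : Finset ι) :
    ∑ i ∈ s, indicatorConstLp p (μ := ν) (hA i) (measure_ne_top _ _) c =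
      indicatorConstLp p (s.measurableSet_biUnion fun i _ => hA i) (measure_ne_top _ _) c := by
  classical
  induction s using Finset.induction_on with
  | empty => simp
  | insert i s hi ih =>
    have h_disj : Disjoint (A i) (⋃ j ∈ s, A j) :=
      Set.disjoint_iUnion₂_right.mpr fun j hj => hd fun hij => hi (hij ▸ hj)
    rw [Finset.sum_insert hi, ih, ← indicatorConstLp_disjoint_union _ _ _ _ h_disj]
    simp only [Finset.set_biUnion_insert]

theorem isSigmaAdditive_indicatorConstLp {E H : Type*} [MeasurableSpace E] [PseudoMetricSpace E]
    [NormedAddCommGroup H] {p : ℝ≥0∞} [Fact (1 ≤ p)] (hp : p ≠ ∞) (ν : Measure E)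
    [IsFiniteMeasure ν] (c : H) : IsSigmaAdditive fun U : BoundedBorel E =>
      indicatorConstLp p (μ := ν) U.measurableSet (measure_ne_top _ _) c := by
  intro A B hd hB
  simp only [HasSum, SummationFilter.unconditional_filter,
    sum_indicatorConstLp_eq_biUnion p ν (fun n => (A n).measurableSet) hd c]
  refine tendsto_indicatorConstLp_set hp ?_
  rw [← hB]
  exact tendsto_measure_symmDiff_biUnion ν fun n => (A n).measurableSet

section QuadraticForm

variable {α ι : Type*} [MeasurableSpace α]

theorem integrable_sq_sum_indicator (ν : Measure α) [IsFiniteMeasure ν] (s : Finset ι) (a : ι → ℝ)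
    {A : ι → Set α} (hA : ∀ i, MeasurableSet (A i)) :
    Integrable (fun x => (∑ i ∈ s, (A i).indicator (fun _ => a i) x) ^ 2) ν :=
  (memLp_finsetSum s fun i _ =>
    memLp_indicator_const 2 (hA i) (a i) (Or.inr (measure_ne_top _ _))).integrable_sq

theorem sum_sum_measureReal_inter (ν : Measure α) [IsFiniteMeasure ν] (s : Finset ι) (a : ι → ℝ)
    {A B : ι → Set α} (hA : ∀ i, MeasurableSet (A i)) (hB : ∀ i, MeasurableSet (B i)) :
    ∑ i ∈ s, ∑ j ∈ s, a i * a j * ν.real (A i ∩ B j) =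
      ∫ x, (∑ i ∈ s, (A i).indicator (fun _ => a i) x) *
        (∑ j ∈ s, (B j).indicator (fun _ => a j) x) ∂ν := by
  have h_int : ∀ i j, Integrable ((A i ∩ B j).indicator fun _ => a i * a j) ν := fun i j =>
    (integrable_const _).indicator ((hA i).inter (hB j))
  simp only [Finset.sum_mul_sum, ← Set.inter_indicator_mul]
  rw [integral_finsetSum _ fun i _ => integrable_finsetSum _ fun j _ => h_int i j]
  simp only [integral_finsetSum _ fun j _ => h_int _ j,
    integral_indicator_const _ ((hA _).inter (hB _)), smul_eq_mul, mul_comm (ν.real _)]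

theorem abs_sum_sum_measureReal_prod_le (ρ : Measure (α × α)) [IsFiniteMeasure ρ] (s : Finset ι)
    (a : ι → ℝ) {A : ι → Set α} (hA : ∀ i, MeasurableSet (A i)) :
    |∑ i ∈ s, ∑ j ∈ s, a i * a j * ρ.real (A i ×ˢ A j)| ≤
      ∫ x, (∑ i ∈ s, (A i).indicator (fun _ => a i) x) ^ 2 ∂(ρ.fst + ρ.snd) := by
  set f : α → ℝ := fun x => ∑ i ∈ s, (A i).indicator (fun _ => a i) x
  have hf : Measurable f :=
    Finset.measurable_fun_sum s fun i _ => measurable_const.indicator (hA i)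
  have h_form : ∑ i ∈ s, ∑ j ∈ s, a i * a j * ρ.real (A i ×ˢ A j) = ∫ z, f z.1 * f z.2 ∂ρ :=
    sum_sum_measureReal_inter ρ s a (fun i => measurable_fst (hA i))
      fun i => measurable_snd (hA i)
  have h_fst : Integrable (fun z : α × α => f z.1 ^ 2) ρ :=
    (integrable_sq_sum_indicator ρ.fst s a hA).comp_measurable measurable_fst
  have h_snd : Integrable (fun z : α × α => f z.2 ^ 2) ρ :=
    (integrable_sq_sum_indicator ρ.snd s a hA).comp_measurable measurable_snd
  have h_marginal : ∫ x, f x ^ 2 ∂(ρ.fst + ρ.snd) = ∫ z, (f z.1 ^ 2 + f z.2 ^ 2) ∂ρ := by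
    rw [integral_add_measure (integrable_sq_sum_indicator ρ.fst s a hA)
      (integrable_sq_sum_indicator ρ.snd s a hA), integral_add h_fst h_snd, Measure.fst,
      Measure.snd, integral_map measurable_fst.aemeasurable (hf.pow_const 2).aestronglyMeasurable,
      integral_map measurable_snd.aemeasurable (hf.pow_const 2).aestronglyMeasurable]
  rw [h_form, h_marginal]
  refine abs_integral_le_integral_abs.trans (integral_mono_of_nonneg
    (ae_of_all _ fun z => abs_nonneg _) (h_fst.add h_snd) (ae_of_all _ fun z => ?_))
  change |f z.1 * f z.2| ≤ f z.1 ^ 2 + f z.2 ^ 2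
  rw [abs_le]
  constructor <;> nlinarith [sq_nonneg (f z.1 + f z.2), sq_nonneg (f z.1 - f z.2)]

/-- The sum of the two marginals of the total variation of `s`. Its `L²` norm dominates the
quadratic form that `s` defines on the simple functions. -/
def marginalVariation (s : SignedMeasure (α × α)) : Measure α :=
  s.totalVariation.fst + s.totalVariation.snd

instance (s : SignedMeasure (α × α)) : IsFiniteMeasure (marginalVariation s) := by
  unfold marginalVariation
  infer_instance

theorem sum_sum_apply_prod_le (σ : SignedMeasure (α × α)) (s : Finset ι) (a : ι → ℝ)
    {A : ι → Set α} (hA : ∀ i, MeasurableSet (A i)) :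
    ∑ i ∈ s, ∑ j ∈ s, a i * a j * σ (A i ×ˢ A j) ≤
      ∫ x, (∑ i ∈ s, (A i).indicator (fun _ => a i) x) ^ 2 ∂(marginalVariation σ) := by
  set μ := σ.toJordanDecomposition.posPart
  set ν := σ.toJordanDecomposition.negPart
  have h_apply : ∀ i j, σ (A i ×ˢ A j) = μ.real (A i ×ˢ A j) - ν.real (A i ×ˢ A j) := fun i j =>
    σ.apply_eq_posPart_real_sub_negPart_real ((hA i).prod (hA j))
  have h_add : marginalVariation σ = (μ.fst + μ.snd) + (ν.fst + ν.snd) := by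
    rw [marginalVariation, SignedMeasure.totalVariation, Measure.fst_add, Measure.snd_add]
    abel
  simp only [h_apply, mul_sub, Finset.sum_sub_distrib]
  rw [h_add, integral_add_measure (integrable_sq_sum_indicator _ s a hA)
    (integrable_sq_sum_indicator _ s a hA)]
  have hμ := le_of_abs_le (abs_sum_sum_measureReal_prod_le μ s a hA)
  have hν := neg_le_of_abs_le (abs_sum_sum_measureReal_prod_le ν s a hA)
  linarith

end QuadraticForm

section InnerProductSpace

variable {ι H K : Type*} [NormedAddCommGroup K] [InnerProductSpace ℝ K]

theorem norm_sum_smul_sq (s : Finset ι) (a : ι → ℝ) (g : ι → K) :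
    ‖∑ i ∈ s, a i • g i‖ ^ 2 = ∑ i ∈ s, ∑ j ∈ s, a i * a j * inner ℝ (g i) (g j) := by
  rw [← real_inner_self_eq_norm_sq, sum_inner]
  refine Finset.sum_congr rfl fun i _ => ?_
  rw [inner_sum]
  refine Finset.sum_congr rfl fun j _ => ?_
  rw [real_inner_smul_left, real_inner_smul_right, mul_assoc]

theorem exists_clm_of_norm_linearCombination_le [CompleteSpace K] [NormedAddCommGroup H]
    [NormedSpace ℝ H] [CompleteSpace H] (f : ι → K) (e : ι → H)
    (h : ∀ c : ι →₀ ℝ, ‖Finsupp.linearCombination ℝ e c‖ ≤ ‖Finsupp.linearCombination ℝ f c‖) :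
    ∃ L : K →L[ℝ] H, ∀ i, L (f i) = e i := by
  let S := (LinearMap.range (Finsupp.linearCombination ℝ f)).topologicalClosure
  have hS : ∀ c, Finsupp.linearCombination ℝ f c ∈ S := fun c =>
    Submodule.le_topologicalClosure _ ⟨c, rfl⟩
  let Φ : (ι →₀ ℝ) →ₗ[ℝ] S := (Finsupp.linearCombination ℝ f).codRestrict S hS
  have h_dense : DenseRange Φ := by
    have h_range : Set.range (Finsupp.linearCombination ℝ f) ⊆ Subtype.val '' Set.range Φ :=
      (Set.range_comp Subtype.val Φ).subset
    exact Subtype.dense_iff.mpr (closure_mono h_range)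
  have : CompleteSpace S :=
    (Submodule.isClosed_topologicalClosure _).completeSpace_coe
  refine ⟨((Finsupp.linearCombination ℝ e).extendOfNorm Φ) ∘L S.orthogonalProjectionOnto,
    fun i => ?_⟩
  have hf : f i = (Φ (Finsupp.single i 1) : K) := by simp [Φ]
  rw [ContinuousLinearMap.comp_apply, hf, Submodule.orthogonalProjectionOnto_mem_subspace_eq_self,
    LinearMap.extendOfNorm_eq h_dense ⟨1, fun c => (h c).trans (one_mul _).ge⟩]
  simp

end InnerProductSpace

variable {E F H : Type*} [MeasurableSpace E] [PseudoMetricSpace E] [MeasurableSpace F]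
  [PseudoMetricSpace F] [NormedAddCommGroup H] [InnerProductSpace ℝ H]

theorem IsSigmaAdditive.norm_sum_smul_sq_le {ι : Type*} {G : BoundedBorel (E × E) → ℝ}
    (hG : IsSigmaAdditive G) {D : BoundedBorel E} {R : ι → BoundedBorel E}
    (hR : ∀ i, (R i).toSet ⊆ D.toSet) {e : ι → H}
    (he : ∀ i j, inner ℝ (e i) (e j) = G ((R i).prod (R j))) (s : Finset ι) (a : ι → ℝ) :
    ‖∑ i ∈ s, a i • e i‖ ^ 2 ≤ ∫ x, (∑ i ∈ s, (R i).toSet.indicator (fun _ => a i) x) ^ 2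
      ∂(marginalVariation (hG.localize (D.prod D))) := by
  have h_gram : ∀ i j, inner ℝ (e i) (e j) =
      hG.localize (D.prod D) ((R i).toSet ×ˢ (R j).toSet) := fun i j =>
    (he i j).trans (hG.localize_toSet (A := (R i).prod (R j)) (D := D.prod D)
      (Set.prod_mono (hR i) (hR j))).symm
  simp only [norm_sum_smul_sq, h_gram]
  exact sum_sum_apply_prod_le _ s a fun i => (R i).measurableSet

theorem exists_isSigmaAdditive_of_gram [CompleteSpace H] {ι : Type*}
    {G : BoundedBorel (E × E) → ℝ} (hG : IsSigmaAdditive G) {D : BoundedBorel E}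
    {R : ι → BoundedBorel E} (hR : ∀ i, (R i).toSet ⊆ D.toSet) {e : ι → H}
    (he : ∀ i j, inner ℝ (e i) (e j) = G ((R i).prod (R j))) :
    ∃ T : BoundedBorel E → H, IsSigmaAdditive T ∧ ∀ i, T (R i) = e i := by
  let ν := marginalVariation (hG.localize (D.prod D))
  let f : ι → Lp ℝ 2 ν := fun i =>
    indicatorConstLp 2 (R i).measurableSet (measure_ne_top _ _) 1
  obtain ⟨L, hL⟩ := exists_clm_of_norm_linearCombination_le f e fun c => by
    refine (sq_le_sq₀ (norm_nonneg _) (norm_nonneg _)).mp ?_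
    rw [Finsupp.linearCombination_apply, Finsupp.linearCombination_apply, Finsupp.sum, Finsupp.sum,
      norm_sum_smul_sq _ c f]
    simp only [f, L2.real_inner_indicatorConstLp_one_indicatorConstLp_one]
    rw [sum_sum_measureReal_inter ν _ c (fun i => (R i).measurableSet) fun i => (R i).measurableSet]
    simp only [← sq]
    exact hG.norm_sum_smul_sq_le hR he c.support c
  exact ⟨_, (isSigmaAdditive_indicatorConstLp (p := 2) (by simp) ν (1 : ℝ)).map L, hL⟩

variable [OpensMeasurableSpace E] [OpensMeasurableSpace F]

theorem extendsToMeasure_of_gram [CompleteSpace H] {G : BoundedBorel ((E × F) × (E × F)) → ℝ}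
    (hG : IsSigmaAdditive G) (e : BoundedBorel E → BoundedBorel F → H)
    (he : ∀ A B A' B', inner ℝ (e A B) (e A' B') = G ((A.prod B).prod (A'.prod B'))) :
    ExtendsToMeasure e := by
  refine extendsToMeasure_of_forall_local fun A₀ B₀ => ?_
  let ι := {R : BoundedBorel E × BoundedBorel F //
    R.1.toSet ⊆ A₀.toSet ∧ R.2.toSet ⊆ B₀.toSet}
  obtain ⟨T, hT, h⟩ := exists_isSigmaAdditive_of_gram hG (D := A₀.prod B₀)
    (R := fun R : ι => R.1.1.prod R.1.2) (fun R => Set.prod_mono R.2.1 R.2.2)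
    (e := fun R => e R.1.1 R.1.2) fun R R' => he _ _ _ _
  exact ⟨T, hT, fun A B hA hB => h ⟨(A, B), hA, hB⟩⟩

theorem IsSigmaAdditive.inner_eq_of_prod {G : BoundedBorel ((E × F) × (E × F)) → ℝ}
    (hG : IsSigmaAdditive G) {T : BoundedBorel (E × F) → H} (hT : IsSigmaAdditive T)
    (h : ∀ (A : BoundedBorel E) (B : BoundedBorel F) (A' : BoundedBorel E) (B' : BoundedBorel F),
      inner ℝ (T (A.prod B)) (T (A'.prod B')) = G ((A.prod B).prod (A'.prod B')))
    (U V : BoundedBorel (E × F)) : inner ℝ (T U) (T V) = G (U.prod V) := by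
  have h_left : ∀ (A : BoundedBorel E) (B : BoundedBorel F),
      inner ℝ (T U) (T (A.prod B)) = G (U.prod (A.prod B)) := fun A B => by
    rw [real_inner_comm]
    refine congrFun ((hT.map (innerSL ℝ (T (A.prod B)))).ext_prod
      (hG.comp (isPullbackOn_prod_right (A.prod B))) fun A' B' => ?_) U
    rw [innerSL_apply_apply, real_inner_comm]
    exact h A' B' A B
  exact congrFun ((hT.map (innerSL ℝ (T U))).ext_prod (hG.comp (isPullbackOn_prod_left U)) h_left) V

end Gram

/-! ### The tensor product -/

section Tensor

variable {Ω E F : Type*} [MeasurableSpace Ω] {P : Measure Ω} [MeasurableSpace E]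
  [PseudoMetricSpace E] [MeasurableSpace F] [PseudoMetricSpace F] {M₁ : BoundedBorel E → Lp ℝ 2 P}
  {M₂ : BoundedBorel F → Lp ℝ 2 P}

theorem IsTensorRandomMeasure.unique [OpensMeasurableSpace E] [OpensMeasurableSpace F]
    {T T' : BoundedBorel (E × F) → Lp ℝ 2 P} (hT : IsTensorRandomMeasure P M₁ M₂ T)
    (hT' : IsTensorRandomMeasure P M₁ M₂ T') : T = T' :=
  hT.isRandomMeasure.sigmaAdditive.ext_prod hT'.isRandomMeasure.sigmaAdditive fun A B => by
    refine Lp.ext ?_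
    filter_upwards [hT.apply_prod A B, hT'.apply_prod A B] with ω h h'
    rw [h, h']

theorem JointlyGaussian.memLp_mul (hG : JointlyGaussian P M₁ M₂) (A : BoundedBorel E)
    (B : BoundedBorel F) : MemLp (fun ω => M₁ A ω * M₂ B ω) 2 P := by
  have h₁ : MemLp (M₁ A) 4 P := (hG.hasGaussianLaw_eval (Sum.inl A)).memLp (by norm_num)
  have h₂ : MemLp (M₂ B) 4 P := (hG.hasGaussianLaw_eval (Sum.inr B)).memLp (by norm_num)
  have : ENNReal.HolderTriple 4 4 2 := ⟨by
    rw [show (4 : ℝ≥0∞) = 2 * 2 by norm_num,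
      ENNReal.mul_inv (by simp) (by simp), ← mul_add, ENNReal.inv_two_add_inv_two, mul_one]⟩
  exact h₂.mul' h₁

theorem JointlyGaussian.exists_isTensorRandomMeasure [IsProbabilityMeasure P]
    [OpensMeasurableSpace E] [OpensMeasurableSpace F] [SecondCountableTopology E]
    [SecondCountableTopology F] (hG : JointlyGaussian P M₁ M₂) (hM₁ : IsRandomMeasure P M₁)
    (hM₂ : IsRandomMeasure P M₂) (hC : HasCrossCovarianceMeasure P M₁ M₂) :
    ∃ T, IsTensorRandomMeasure P M₁ M₂ T := by
  obtain ⟨G, hGσ, h_moment⟩ := hG.exists_fourthMoment hM₁ hM₂ hC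
  let e : BoundedBorel E → BoundedBorel F → Lp ℝ 2 P := fun A B => (hG.memLp_mul A B).toLp _
  have h_gram : ∀ A B A' B', inner ℝ (e A B) (e A' B') = G ((A.prod B).prod (A'.prod B')) := by
    intro A B A' B'
    rw [h_moment, inner_eq_integral_mul]
    exact integral_congr_ae ((hG.memLp_mul A B).coeFn_toLp.mul (hG.memLp_mul A' B').coeFn_toLp)
  obtain ⟨T, hT, hTe⟩ := extendsToMeasure_of_gram hGσ e h_gram
  have h_inner : ExtendsToMeasure fun U V => inner ℝ (T U) (T V) :=
    ⟨G, hGσ, fun U V => (hGσ.inner_eq_of_prod hT (by simpa only [hTe] using h_gram) U V).symm⟩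
  refine ⟨T, ⟨hT, (extendsToMeasure_cov_iff hT hT).mpr h_inner⟩, fun A B => ?_⟩
  rw [hTe]
  exact (hG.memLp_mul A B).coeFn_toLp

end Tensor

/-! ### Integrals of deterministic functions -/

namespace SimpleFn

variable {E F : Type*} [MeasurableSpace E] [PseudoMetricSpace E] [MeasurableSpace F]
  [PseudoMetricSpace F] {Ω : Type*} [MeasurableSpace Ω] {P : Measure Ω}

/-- The sum of two simple functions. -/
def add (s t : SimpleFn E) : SimpleFn E :=
  ⟨s.size + t.size, Fin.append s.coeff t.coeff, Fin.append s.set t.set⟩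

theorem eval_add (s t : SimpleFn E) : (s.add t).eval = s.eval + t.eval := by
  funext x
  refine (Fin.sum_univ_add _).trans ?_
  simp only [add, Fin.append_left, Fin.append_right]
  rfl

theorem integral_add (s t : SimpleFn E) (M : BoundedBorel E → Lp ℝ 2 P) :
    (s.add t).integral M = s.integral M + t.integral M := by
  refine (Fin.sum_univ_add _).trans ?_
  simp only [add, Fin.append_left, Fin.append_right]
  rfl

theorem set_add_subset {s t : SimpleFn E} {S T : Set E} (hs : ∀ i, (s.set i).toSet ⊆ S)
    (ht : ∀ i, (t.set i).toSet ⊆ T) (i) : ((s.add t).set i).toSet ⊆ S ∪ T := by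
  refine Fin.addCases (fun i => ?_) (fun i => ?_) i
  · simpa only [add, Fin.append_left] using Set.subset_union_of_subset_left (hs i) T
  · simpa only [add, Fin.append_right] using Set.subset_union_of_subset_right (ht i) S

/-- The product of a simple function with a constant. -/
def smul (c : ℂ) (s : SimpleFn E) : SimpleFn E :=
  ⟨s.size, fun i => c * s.coeff i, s.set⟩

theorem eval_smul (c : ℂ) (s : SimpleFn E) : (s.smul c).eval = c • s.eval := by
  funext x
  simp only [eval, smul, Pi.smul_apply, smul_eq_mul, Finset.mul_sum, Set.indicator_const_mul]
  rfl

theorem integral_smul (c : ℂ) (s : SimpleFn E) (M : BoundedBorel E → Lp ℝ 2 P) :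
    (s.smul c).integral M = c • s.integral M := by
  simp only [integral, smul, Finset.smul_sum, mul_smul]
  rfl

/-- The simple function obtained by transforming the sets `Aᵢ` of `∑ᵢ cᵢ 𝟙_{Aᵢ}`. -/
def map (f : BoundedBorel E → BoundedBorel F) (s : SimpleFn E) : SimpleFn F :=
  ⟨s.size, s.coeff, f ∘ s.set⟩

theorem eval_map {U : Set F} {π : F → E} {f : BoundedBorel E → BoundedBorel F}
    (hf : IsPullbackOn U π f) (s : SimpleFn E) :
    (s.map f).eval = U.indicator (s.eval ∘ π) := by
  funext y
  simp only [eval, map, Function.comp_apply, hf _, ← Set.indicator_indicator]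
  by_cases hy : y ∈ U
  · simp only [Set.indicator_of_mem hy]
    rfl
  · simp only [Set.indicator_of_notMem hy, Finset.sum_const_zero]

theorem integral_map (f : BoundedBorel E → BoundedBorel F) (s : SimpleFn E)
    (M : BoundedBorel F → Lp ℝ 2 P) : (s.map f).integral M = s.integral (M ∘ f) :=
  rfl

theorem coeFn_integral (s : SimpleFn E) (M : BoundedBorel E → Lp ℝ 2 P) :
    s.integral M =ᵐ[P] fun ω => ∑ i, s.coeff i * (M (s.set i) ω : ℂ) := by
  have h_term : ∀ᵐ ω ∂P, ∀ i, (s.coeff i • Complex.ofRealCLM.compLp (M (s.set i)) : Lp ℂ 2 P) ω =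
      s.coeff i * (M (s.set i) ω : ℂ) := by
    refine ae_all_iff.mpr fun i => ?_
    filter_upwards [Lp.coeFn_smul (s.coeff i) (Complex.ofRealCLM.compLp (M (s.set i))),
      Complex.ofRealCLM.coeFn_compLp (M (s.set i))] with ω h_smul h_comp
    rw [h_smul, Pi.smul_apply, h_comp, smul_eq_mul, Complex.ofRealCLM_apply]
  filter_upwards [h_term, Lp.coeFn_fun_finsetSum Finset.univ
    fun i => (s.coeff i • Complex.ofRealCLM.compLp (M (s.set i)) : Lp ℂ 2 P)] with ω h h_sum
  rw [integral, h_sum]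
  exact Finset.sum_congr rfl fun i _ => h i

end SimpleFn

namespace Approximates

variable {E F : Type*} [MeasurableSpace E] [PseudoMetricSpace E] [MeasurableSpace F]
  [PseudoMetricSpace F] {s t : ℕ → SimpleFn E} {φ φ' : E → ℂ}

theorem add (hs : Approximates s φ) (ht : Approximates t φ') :
    Approximates (fun n => (s n).add (t n)) (φ + φ') := by
  obtain ⟨⟨D, hD⟩, hs⟩ := hs
  obtain ⟨⟨D', hD'⟩, ht⟩ := ht
  refine ⟨⟨D.union D', fun n => SimpleFn.set_add_subset (hD n) (hD' n)⟩, ?_⟩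
  simp only [SimpleFn.eval_add]
  exact hs.add ht

theorem smul (hs : Approximates s φ) (c : ℂ) :
    Approximates (fun n => (s n).smul c) (c • φ) := by
  refine ⟨hs.1, ?_⟩
  simp only [SimpleFn.eval_smul]
  exact (uniformContinuous_const_smul c).comp_tendstoUniformly hs.2

theorem map (hs : Approximates s φ) {U : Set F} {π : F → E} {f : BoundedBorel E → BoundedBorel F}
    (hf : IsPullbackOn U π f) :
    Approximates (fun n => (s n).map f) (U.indicator (φ ∘ π)) := by
  obtain ⟨⟨D, hD⟩, hs⟩ := hs
  refine ⟨⟨f D, fun n i => hf.subset (hD n i)⟩, ?_⟩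
  simp only [SimpleFn.eval_map hf]
  rw [Metric.tendstoUniformly_iff] at hs ⊢
  intro ε hε
  filter_upwards [hs ε hε] with n hn y
  by_cases hy : y ∈ U
  · simpa only [Set.indicator_of_mem hy, Function.comp_apply] using hn (π y)
  · simpa only [Set.indicator_of_notMem hy, dist_self] using hε

end Approximates

/-- `M` has bounded semivariation on every bounded set: the integrals of the simple functions
supported in it are bounded by a multiple of the supremum norm. -/
def BoundedSemivariation {Ω E : Type*} [MeasurableSpace Ω] [MeasurableSpace E]
    [PseudoMetricSpace E] {P : Measure Ω} (M : BoundedBorel E → Lp ℝ 2 P) : Prop :=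
  ∀ D : BoundedBorel E, ∃ C : NNReal, ∀ (s : SimpleFn E) (K : ℝ),
    (∀ i, (s.set i).toSet ⊆ D.toSet) → 0 ≤ K → (∀ x, ‖s.eval x‖ ≤ K) → ‖s.integral M‖ ≤ C * K

section Semivariation

variable {E F : Type*} [MeasurableSpace E] [PseudoMetricSpace E] [MeasurableSpace F]
  [PseudoMetricSpace F] {Ω : Type*} [MeasurableSpace Ω] {P : Measure Ω}

theorem BoundedSemivariation.comp {M : BoundedBorel F → Lp ℝ 2 P} (hM : BoundedSemivariation M)
    {U : Set F} {π : F → E} {f : BoundedBorel E → BoundedBorel F} (hf : IsPullbackOn U π f) :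
    BoundedSemivariation (M ∘ f) := by
  intro D
  obtain ⟨C, hC⟩ := hM (f D)
  refine ⟨C, fun s K hs hK hsK => hC (s.map f) K (fun i => hf.subset (hs i)) hK fun y => ?_⟩
  rw [SimpleFn.eval_map hf]
  exact (norm_indicator_le_norm_self _ y).trans (hsK (π y))

theorem norm_sum_smul_compLp_ofReal_le {ι : Type*} (s : Finset ι) (c : ι → ℂ)
    (X : ι → Lp ℝ 2 P) :
    ‖∑ i ∈ s, c i • Complex.ofRealCLM.compLp (X i)‖ ≤
      ‖∑ i ∈ s, (c i).re • X i‖ + ‖∑ i ∈ s, (c i).im • X i‖ := by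
  let J : Lp ℝ 2 P →L[ℝ] Lp ℂ 2 P := Complex.ofRealCLM.compLpL 2 P
  have hJ : ∀ Y, ‖J Y‖ ≤ ‖Y‖ := fun Y =>
    (Complex.ofRealCLM.norm_compLp_le Y).trans (by simp)
  have h_split : ∑ i ∈ s, c i • Complex.ofRealCLM.compLp (X i) =
      J (∑ i ∈ s, (c i).re • X i) + Complex.I • J (∑ i ∈ s, (c i).im • X i) := by
    simp only [map_sum, map_smul, Finset.smul_sum, ← Finset.sum_add_distrib]
    refine Finset.sum_congr rfl fun i _ => ?_
    conv_lhs => rw [← Complex.re_add_im (c i), add_smul, mul_comm, mul_smul]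
    rfl
  rw [h_split]
  refine (norm_add_le _ _).trans (add_le_add (hJ _) ?_)
  rw [norm_smul, Complex.norm_I, one_mul]
  exact hJ _

theorem IsRandomMeasure.exists_norm_sum_smul_le [OpensMeasurableSpace E] [IsProbabilityMeasure P]
    {M : BoundedBorel E → Lp ℝ 2 P} (hM : IsRandomMeasure P M) (D : BoundedBorel E) :
    ∃ C : NNReal, ∀ (n : ℕ) (A : Fin n → BoundedBorel E) (a : Fin n → ℝ) (K : ℝ),
      (∀ i, (A i).toSet ⊆ D.toSet) → 0 ≤ K →
      (∀ x, |∑ i, (A i).toSet.indicator (fun _ => a i) x| ≤ K) → ‖∑ i, a i • M (A i)‖ ≤ C * K := by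
  obtain ⟨G, hG, hGM⟩ := hM.extendsToMeasure_inner
  let ν := marginalVariation (hG.localize (D.prod D))
  refine ⟨NNReal.sqrt (ν Set.univ).toNNReal, fun n A a K hA hK ha => ?_⟩
  refine (sq_le_sq₀ (norm_nonneg _) (by positivity)).mp ?_
  calc ‖∑ i, a i • M (A i)‖ ^ 2
      ≤ ∫ x, (∑ i, (A i).toSet.indicator (fun _ => a i) x) ^ 2 ∂ν :=
        hG.norm_sum_smul_sq_le hA (fun i j => (hGM _ _).symm) Finset.univ a
    _ ≤ ∫ _, K ^ 2 ∂ν := integral_mono_of_nonneg (ae_of_all _ fun x => sq_nonneg _)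
        (integrable_const _) (ae_of_all _ fun x => sq_le_sq' (abs_le.mp (ha x)).1
          (abs_le.mp (ha x)).2)
    _ = (NNReal.sqrt (ν Set.univ).toNNReal * K) ^ 2 := by
        rw [integral_const, smul_eq_mul, mul_pow, ← NNReal.coe_pow, NNReal.sq_sqrt]
        rfl

theorem IsRandomMeasure.boundedSemivariation [OpensMeasurableSpace E] [IsProbabilityMeasure P]
    {M : BoundedBorel E → Lp ℝ 2 P} (hM : IsRandomMeasure P M) : BoundedSemivariation M := by
  intro D
  obtain ⟨C, hC⟩ := hM.exists_norm_sum_smul_le D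
  refine ⟨C + C, fun s K hs hK hsK => ?_⟩
  refine (norm_sum_smul_compLp_ofReal_le _ _ _).trans ?_
  rw [NNReal.coe_add, add_mul]
  refine add_le_add (hC _ _ _ K hs hK fun x => ?_) (hC _ _ _ K hs hK fun x => ?_)
  · refine le_trans (le_of_eq ?_) ((Complex.abs_re_le_norm _).trans (hsK x))
    rw [SimpleFn.eval, Complex.re_sum]
    exact congrArg abs (Finset.sum_congr rfl fun i _ =>
      congrFun (Set.indicator_comp_of_zero (f := fun _ => s.coeff i) Complex.zero_re) x)
  · refine le_trans (le_of_eq ?_) ((Complex.abs_im_le_norm _).trans (hsK x))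
    rw [SimpleFn.eval, Complex.im_sum]
    exact congrArg abs (Finset.sum_congr rfl fun i _ =>
      congrFun (Set.indicator_comp_of_zero (f := fun _ => s.coeff i) Complex.zero_im) x)

end Semivariation

section Integral

variable {E F : Type*} [MeasurableSpace E] [PseudoMetricSpace E] [MeasurableSpace F]
  [PseudoMetricSpace F] {Ω : Type*} [MeasurableSpace Ω] {P : Measure Ω}
  {M : BoundedBorel E → Lp ℝ 2 P} {φ φ' : E → ℂ} {X X' : Lp ℂ 2 P}

theorem BoundedSemivariation.tendsto_integral_sub (hM : BoundedSemivariation M) {ι : Type*}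
    {l : Filter ι} {s t : ι → SimpleFn E} {D D' : BoundedBorel E}
    (hD : ∀ n i, ((s n).set i).toSet ⊆ D.toSet) (hD' : ∀ n i, ((t n).set i).toSet ⊆ D'.toSet)
    (hs : TendstoUniformly (fun n => (s n).eval) φ l)
    (ht : TendstoUniformly (fun n => (t n).eval) φ l) :
    Tendsto (fun n => (s n).integral M - (t n).integral M) l (𝓝 0) := by
  obtain ⟨C, hC⟩ := hM (D.union D')
  rw [Metric.tendsto_nhds]
  intro ε hε
  obtain ⟨K, hK, hCK⟩ := exists_pos_mul_lt hε C
  have h_unif := Metric.tendstoUniformly_iff.mp (hs.sub ht) K hK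
  filter_upwards [h_unif] with n hn
  have h_integral : (s n).integral M - (t n).integral M =
      ((s n).add ((t n).smul (-1))).integral M := by
    rw [SimpleFn.integral_add, SimpleFn.integral_smul, neg_one_smul, sub_eq_add_neg]
  rw [dist_zero_right, h_integral]
  refine (hC _ K (SimpleFn.set_add_subset (t := (t n).smul (-1)) (hD n) (hD' n)) hK.le
    fun x => ?_).trans_lt hCK
  rw [SimpleFn.eval_add, SimpleFn.eval_smul, neg_one_smul, ← sub_eq_add_neg]
  simpa only [Pi.sub_apply, sub_self, dist_zero_left] using (hn x).le

theorem Approximates.hasIntegral {s : ℕ → SimpleFn E} (hs : Approximates s φ)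
    (hM : BoundedSemivariation M) (hX : Tendsto (fun n => (s n).integral M) atTop (𝓝 X)) :
    HasIntegral M φ X where
  exists_approx := ⟨s, hs⟩
  tendsto t ht := by
    obtain ⟨D, hD⟩ := hs.1
    obtain ⟨D', hD'⟩ := ht.1
    simpa using hX.sub (hM.tendsto_integral_sub hD hD' hs.2 ht.2)

theorem Approximates.exists_hasIntegral {s : ℕ → SimpleFn E} (hs : Approximates s φ)
    (hM : BoundedSemivariation M) : ∃ X, HasIntegral M φ X := by
  obtain ⟨D, hD⟩ := hs.1
  have h_cauchy : CauchySeq fun n => (s n).integral M := by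
    rw [cauchySeq_iff_tendsto_dist_atTop_0, ← prod_atTop_atTop_eq]
    simp only [dist_eq_norm]
    exact tendsto_zero_iff_norm_tendsto_zero.mp (hM.tendsto_integral_sub
      (fun n => hD n.1) (fun n => hD n.2) (fun u hu => tendsto_fst.eventually (hs.2 u hu))
      fun u hu => tendsto_snd.eventually (hs.2 u hu))
  obtain ⟨X, hX⟩ := cauchySeq_tendsto_of_complete h_cauchy
  exact ⟨X, hs.hasIntegral hM hX⟩

namespace HasIntegral

theorem add (h : HasIntegral M φ X) (h' : HasIntegral M φ' X') (hM : BoundedSemivariation M) :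
    HasIntegral M (φ + φ') (X + X') := by
  obtain ⟨s, hs⟩ := h.exists_approx
  obtain ⟨t, ht⟩ := h'.exists_approx
  refine (hs.add ht).hasIntegral hM ?_
  simpa only [SimpleFn.integral_add] using (h.tendsto s hs).add (h'.tendsto t ht)

theorem const_smul (h : HasIntegral M φ X) (c : ℂ) (hM : BoundedSemivariation M) :
    HasIntegral M (c • φ) (c • X) := by
  obtain ⟨s, hs⟩ := h.exists_approx
  refine (hs.smul c).hasIntegral hM ?_
  simpa only [SimpleFn.integral_smul] using (h.tendsto s hs).const_smul c

theorem sub (h : HasIntegral M φ X) (h' : HasIntegral M φ' X') (hM : BoundedSemivariation M) :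
    HasIntegral M (φ - φ') (X - X') := by
  simpa only [neg_one_smul, ← sub_eq_add_neg] using h.add (h'.const_smul (-1) hM) hM

theorem zero (hM : BoundedSemivariation M) : HasIntegral M 0 0 := by
  have h_approx : Approximates (fun _ => (⟨0, Fin.elim0, Fin.elim0⟩ : SimpleFn E)) 0 :=
    ⟨⟨⟨∅, MeasurableSet.empty, Bornology.isBounded_empty⟩, fun _ i => i.elim0⟩,
      Metric.tendstoUniformly_iff.mpr fun ε hε => Eventually.of_forall fun n x => by
        simpa [SimpleFn.eval] using hε⟩
  refine h_approx.hasIntegral hM ?_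
  simp [SimpleFn.integral]

theorem finset_sum {ι : Type*} {φ : ι → E → ℂ} {X : ι → Lp ℂ 2 P} (t : Finset ι)
    (h : ∀ i ∈ t, HasIntegral M (φ i) (X i)) (hM : BoundedSemivariation M) :
    HasIntegral M (∑ i ∈ t, φ i) (∑ i ∈ t, X i) := by
  classical
  induction t using Finset.induction_on with
  | empty => exact zero hM
  | insert i t hi ih =>
    simp only [Finset.sum_insert hi]
    exact (h i (Finset.mem_insert_self i t)).add
      (ih fun j hj => h j (Finset.mem_insert_of_mem hj)) hM

theorem exists_indicator (h : HasIntegral M φ X) {U : Set E} (hU : MeasurableSet U)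
    (hM : BoundedSemivariation M) : ∃ Y, HasIntegral M (U.indicator φ) Y := by
  obtain ⟨s, hs⟩ := h.exists_approx
  exact (hs.map (isPullbackOn_trace hU)).exists_hasIntegral hM

theorem map {U : Set E} {π : E → F} {f : BoundedBorel F → BoundedBorel E} {φ : F → ℂ}
    (h : HasIntegral (M ∘ f) φ X) (hf : IsPullbackOn U π f) (hM : BoundedSemivariation M) :
    HasIntegral M (U.indicator (φ ∘ π)) X := by
  obtain ⟨s, hs⟩ := h.exists_approx
  exact (hs.map hf).hasIntegral hM (h.tendsto s hs)

end HasIntegral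

theorem BoundedSemivariation.exists_norm_le (hM : BoundedSemivariation M) (D : BoundedBorel E) :
    ∃ C : NNReal, ∀ (φ : E → ℂ) (X : Lp ℂ 2 P) (K : ℝ), HasIntegral M φ X →
      (∀ x ∉ D.toSet, φ x = 0) → 0 ≤ K → (∀ x, ‖φ x‖ ≤ K) → ‖X‖ ≤ C * K := by
  obtain ⟨C, hC⟩ := hM D
  refine ⟨C, fun φ X K hX hφD hK hφK => ?_⟩
  obtain ⟨s, hs⟩ := hX.exists_approx
  have h_restrict := hs.map (isPullbackOn_trace D.measurableSet)
  rw [Function.comp_id, Set.indicator_eq_self.mpr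
    fun x hx => by_contra fun hxD => hx (hφD x hxD)] at h_restrict
  have h_le : ∀ δ > 0, ‖X‖ ≤ C * (K + δ) := by
    intro δ hδ
    refine le_of_tendsto (hX.tendsto _ h_restrict).norm ?_
    filter_upwards [Metric.tendstoUniformly_iff.mp h_restrict.2 δ hδ] with n hn
    refine hC _ (K + δ) (fun i => Set.inter_subset_left) (by positivity) fun x => ?_
    exact (norm_le_norm_add_norm_sub (φ x) _).trans
      (add_le_add (hφK x) ((dist_eq_norm (φ x) _).symm.trans_le (hn x).le))
  have h_lim : Tendsto (fun δ : ℝ => C * (K + δ)) (𝓝[>] 0) (𝓝 (C * (K + 0))) :=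
    ((continuous_const.add continuous_id).const_mul _).continuousWithinAt
  rw [add_zero] at h_lim
  exact ge_of_tendsto h_lim (eventually_mem_nhdsWithin.mono h_le)

theorem HasIntegral.tendsto_of_tendstoUniformly {ι : Type*} {l : Filter ι} {φ : ι → E → ℂ}
    {φ₀ : E → ℂ} {X : ι → Lp ℂ 2 P} {X₀ : Lp ℂ 2 P} (h : ∀ n, HasIntegral M (φ n) (X n))
    (h₀ : HasIntegral M φ₀ X₀) (hM : BoundedSemivariation M) {D : BoundedBorel E}
    (hD : ∀ n, ∀ x ∉ D.toSet, φ n x = φ₀ x) (hφ : TendstoUniformly φ φ₀ l) :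
    Tendsto X l (𝓝 X₀) := by
  obtain ⟨C, hC⟩ := hM.exists_norm_le D
  rw [Metric.tendsto_nhds]
  intro ε hε
  obtain ⟨K, hK, hCK⟩ := exists_pos_mul_lt hε C
  filter_upwards [Metric.tendstoUniformly_iff.mp hφ K hK] with n hn
  rw [dist_eq_norm]
  refine (hC _ _ K ((h n).sub h₀ hM) (fun x hx => sub_eq_zero.mpr (hD n x hx)) hK.le
    fun x => ?_).trans_lt hCK
  rw [Pi.sub_apply, ← dist_eq_norm, dist_comm]
  exact (hn x).le

end Integral

/-! ### Riemann systems -/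

section Riemann

variable {E : Type*} [MeasurableSpace E] [PseudoMetricSpace E] {D : BoundedBorel E}

theorem exists_measurable_partition_ediam_le [OpensMeasurableSpace E] {S : Set E}
    (hS : TotallyBounded S) {ε : ℝ≥0∞} (hε : 0 < ε) :
    ∃ (k : ℕ) (c : Fin k → Set E), (∀ j, MeasurableSet (c j)) ∧
      Pairwise (fun i j => Disjoint (c i) (c j)) ∧ S ⊆ ⋃ j, c j ∧
      ∀ j, Metric.ediam (c j) ≤ ε := by
  obtain ⟨t, ht, hSt⟩ := EMetric.totallyBounded_iff.mp hS (ε / 2) (ENNReal.half_pos hε.ne')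
  obtain ⟨k, center, -, rfl⟩ := ht.fin_param
  let b : Fin k → Set E := fun j => Metric.eball (center j) (ε / 2)
  refine ⟨k, disjointed b, fun j => ?_, disjoint_disjointed b, ?_, fun j => ?_⟩
  · exact disjointedRec (fun _ _ h => h.diff Metric.isOpen_eball.measurableSet)
      Metric.isOpen_eball.measurableSet
  · rwa [iUnion_disjointed, ← Set.biUnion_range (g := fun y => Metric.eball y (ε / 2))]
  · calc Metric.ediam (disjointed b j)
        ≤ Metric.ediam (b j) := Metric.ediam_mono (disjointed_subset b j)
      _ ≤ 2 * (ε / 2) := Metric.ediam_eball_le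
      _ = ε := ENNReal.mul_div_cancel two_ne_zero ENNReal.ofNat_ne_top

theorem BoundedBorel.exists_taggedPartition [OpensMeasurableSpace E]
    (hD : TotallyBounded D.toSet) {ε : ℝ≥0∞} (hε : 0 < ε) :
    ∃ (k : ℕ) (cell : Fin k → BoundedBorel E) (tag : Fin k → E),
      Pairwise (fun i j => Disjoint (cell i).toSet (cell j).toSet) ∧
      (⋃ j, (cell j).toSet) = D.toSet ∧ (∀ j, tag j ∈ (cell j).toSet) ∧
      ∀ j, Metric.ediam (cell j).toSet ≤ ε := by
  classical
  obtain ⟨k, c, hc_meas, hc_disj, hDc, hcε⟩ := exists_measurable_partition_ediam_le hD hε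
  -- only the nonempty cells can be tagged
  let ι := {j : Fin k // (c j ∩ D.toSet).Nonempty}
  let e : Fin (Fintype.card ι) ≃ ι := (Fintype.equivFin ι).symm
  refine ⟨Fintype.card ι, fun j => D.trace (c (e j)) (hc_meas _), fun j => (e j).2.some,
    fun i j hij => ?_, ?_, fun j => (e j).2.some_mem, fun j => ?_⟩
  · have h_ne : (e i : Fin k) ≠ e j := fun h => hij (e.injective (Subtype.ext h))
    exact (hc_disj h_ne).mono Set.inter_subset_left Set.inter_subset_left
  · refine Set.Subset.antisymm (Set.iUnion_subset fun j => Set.inter_subset_right) fun x hx => ?_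
    obtain ⟨j, hj⟩ := Set.mem_iUnion.mp (hDc hx)
    refine Set.mem_iUnion.mpr ⟨e.symm ⟨j, x, hj, hx⟩, ?_⟩
    simpa using And.intro hj hx
  · exact (Metric.ediam_mono Set.inter_subset_left).trans (hcε _)

namespace RiemannSystem

theorem nonempty_of_totallyBounded [OpensMeasurableSpace E] (hD : TotallyBounded D.toSet) :
    Nonempty (RiemannSystem D) := by
  choose size cell tag h_disj h_union h_tag h_diam using fun n : ℕ =>
    BoundedBorel.exists_taggedPartition hD
      (ENNReal.inv_pos.mpr (ENNReal.natCast_ne_top n))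
  exact ⟨⟨size, cell, tag, h_disj, h_union, h_tag,
    tendsto_of_tendsto_of_tendsto_of_le_of_le tendsto_const_nhds
      ENNReal.tendsto_inv_nat_nhds_zero (fun _ => zero_le) fun n => iSup_le (h_diam n)⟩⟩

instance [ProperSpace E] [OpensMeasurableSpace E] : Nonempty (RiemannSystem D) :=
  nonempty_of_totallyBounded
    (D.isBounded.isCompact_closure.totallyBounded.subset subset_closure)

theorem cell_subset (R : RiemannSystem D) (n : ℕ) (j : Fin (R.size n)) :
    (R.cell n j).toSet ⊆ D.toSet :=
  (Set.subset_iUnion (fun j => (R.cell n j).toSet) j).trans (R.iUnion_eq n).subset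

theorem eventually_dist_tag_lt (R : RiemannSystem D) {δ : ℝ} (hδ : 0 < δ) :
    ∀ᶠ n in atTop, ∀ j, ∀ x ∈ (R.cell n j).toSet, dist x (R.tag n j) < δ := by
  filter_upwards [R.mesh_tendsto.eventually_lt_const (ENNReal.ofReal_pos.mpr hδ)] with n hn j x hx
  rw [← ENNReal.ofReal_lt_ofReal_iff hδ, ← edist_dist]
  exact ((Metric.edist_le_ediam_of_mem hx (R.tag_mem n j)).trans
    (le_iSup (fun j => Metric.ediam (R.cell n j).toSet) j)).trans_lt hn

/-- The step function which takes on each cell of the `n`-th partition the value of `g` at the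
tag. -/
def stepFn (R : RiemannSystem D) (g : E → ℂ) (n : ℕ) : SimpleFn E :=
  ⟨R.size n, fun j => g (R.tag n j), R.cell n⟩

theorem eval_stepFn_of_mem (R : RiemannSystem D) (g : E → ℂ) {n : ℕ} {j : Fin (R.size n)} {x : E}
    (hx : x ∈ (R.cell n j).toSet) : (R.stepFn g n).eval x = g (R.tag n j) := by
  refine (Finset.sum_eq_single j (fun i _ hij => ?_) fun h => (h (Finset.mem_univ j)).elim).trans
    (Set.indicator_of_mem hx _)
  exact Set.indicator_of_notMem (Set.disjoint_right.mp (R.disjoint n hij) hx) _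

theorem eval_stepFn_of_notMem (R : RiemannSystem D) (g : E → ℂ) (n : ℕ) {x : E}
    (hx : x ∉ D.toSet) : (R.stepFn g n).eval x = 0 :=
  Finset.sum_eq_zero fun j _ => Set.indicator_of_notMem (fun h => hx (R.cell_subset n j h)) _

theorem tendstoUniformly_eval_stepFn (R : RiemannSystem D) {ι : Type*} {g : ι → E → ℂ}
    (hg : UniformEquicontinuous g) :
    TendstoUniformly (fun n (z : ι × E) => (R.stepFn (g z.1) n).eval z.2)
      (fun z => D.toSet.indicator (g z.1) z.2) atTop := by
  rw [Metric.tendstoUniformly_iff]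
  intro ε hε
  obtain ⟨δ, hδ, hgδ⟩ := Metric.uniformEquicontinuous_iff.mp hg ε hε
  filter_upwards [R.eventually_dist_tag_lt hδ] with n hn z
  by_cases hx : z.2 ∈ D.toSet
  · obtain ⟨j, hj⟩ := Set.mem_iUnion.mp ((R.iUnion_eq n).symm ▸ hx)
    rw [Set.indicator_of_mem hx, R.eval_stepFn_of_mem _ hj]
    exact hgδ _ _ (hn j z.2 hj) z.1
  · rwa [Set.indicator_of_notMem hx, R.eval_stepFn_of_notMem _ _ hx, dist_self]

end RiemannSystem

theorem exists_approximates_of_hasCompactSupport [OpensMeasurableSpace E] {φ : E → ℂ}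
    (hφ : Continuous φ) (hc : HasCompactSupport φ) : ∃ s : ℕ → SimpleFn E, Approximates s φ := by
  let D : BoundedBorel E :=
    ⟨tsupport φ, (isClosed_tsupport φ).measurableSet, hc.isCompact.isBounded⟩
  obtain ⟨R⟩ : Nonempty (RiemannSystem D) :=
    RiemannSystem.nonempty_of_totallyBounded hc.isCompact.totallyBounded
  refine ⟨R.stepFn φ, ⟨D, fun n j => R.cell_subset n j⟩, ?_⟩
  have h_equi : UniformEquicontinuous fun _ : Unit => φ :=
    uniformEquicontinuous_unique.mpr (hc.uniformContinuous_of_continuous hφ)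
  have h_lim := (R.tendstoUniformly_eval_stepFn h_equi).comp fun x => ((), x)
  rwa [show (fun z : Unit × E => D.toSet.indicator φ z.2) ∘ (fun x => ((), x)) = φ from
    Set.indicator_eq_self.mpr (subset_tsupport φ)] at h_lim

end Riemann

/-! ### Iterated integrals -/

theorem ae_eq_mul_of_tendsto_Lp {Ω 𝕜 : Type*} [MeasurableSpace Ω] {P : Measure Ω} [NormedRing 𝕜]
    {p q : ℝ≥0∞} [Fact (1 ≤ p)] [Fact (1 ≤ q)] {X : ℕ → Lp 𝕜 p P} {Y : ℕ → Lp 𝕜 q P}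
    {Z : Lp 𝕜 p P} {W : Lp 𝕜 q P} {g : Ω → 𝕜} (hX : Tendsto X atTop (𝓝 Z))
    (hY : Tendsto Y atTop (𝓝 W)) (h : ∀ n, Y n =ᵐ[P] fun ω => X n ω * g ω) :
    W =ᵐ[P] fun ω => Z ω * g ω := by
  obtain ⟨u, hu, hXu⟩ := (tendstoInMeasure_of_tendsto_Lp hX).exists_seq_tendsto_ae
  obtain ⟨v, hv, hYv⟩ := (tendstoInMeasure_of_tendsto_Lp
    (hY.comp hu.tendsto_atTop)).exists_seq_tendsto_ae
  filter_upwards [hXu, hYv, ae_all_iff.mpr h] with ω hXω hYω hω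
  simp only [Function.comp_apply, hω] at hYω
  exact tendsto_nhds_unique hYω ((hXω.comp hv.tendsto_atTop).mul_const _)

section Iterated

variable {E F : Type*} [MeasurableSpace E] [PseudoMetricSpace E] [MeasurableSpace F]
  [PseudoMetricSpace F] {Ω : Type*} [MeasurableSpace Ω] {P : Measure Ω}
  {M₁ : BoundedBorel E → Lp ℝ 2 P} {M₂ : BoundedBorel F → Lp ℝ 2 P}
  {T : BoundedBorel (E × F) → Lp ℝ 2 P}

theorem HasIntegral.continuous_of_uniformContinuous {F : Type*} [UniformSpace F]
    (hM : BoundedSemivariation M₁) {ψ : E × F → ℂ} (hψ : UniformContinuous ψ) {A : BoundedBorel E}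
    (hψA : ∀ x ∉ A.toSet, ∀ y, ψ (x, y) = 0) {Z : F → Lp ℂ 2 P}
    (hZ : ∀ y, HasIntegral M₁ (fun x => ψ (x, y)) (Z y)) : Continuous Z := by
  have h_unif : UniformContinuous₂ fun y x => ψ (x, y) := hψ.comp uniformContinuous_swap
  refine continuous_iff_continuousAt.mpr fun y₀ => ?_
  exact HasIntegral.tendsto_of_tendstoUniformly hZ (hZ y₀) hM
    (fun y x hx => (hψA x hx y).trans (hψA x hx y₀).symm) h_unif.tendstoUniformly

theorem exists_boundedBorel_forall_eq_zero [OpensMeasurableSpace E] [OpensMeasurableSpace F]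
    {β : Type*} [Zero β] {ψ : E × F → β} (hc : HasCompactSupport ψ) :
    ∃ (A : BoundedBorel E) (B : BoundedBorel F),
      (∀ x ∉ A.toSet, ∀ y, ψ (x, y) = 0) ∧ ∀ x, ∀ y ∉ B.toSet, ψ (x, y) = 0 := by
  obtain ⟨h₁, h₂⟩ := Bornology.isBounded_image_fst_and_snd.mpr hc.isCompact.isBounded
  refine ⟨.closure _ h₁, .closure _ h₂, fun x hx y => ?_, fun x y hy => ?_⟩ <;>
    by_contra h
  · exact hx (BoundedBorel.subset_closure h₁ ⟨_, subset_tsupport ψ h, rfl⟩)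
  · exact hy (BoundedBorel.subset_closure h₂ ⟨_, subset_tsupport ψ h, rfl⟩)

theorem HasStochIntegralOn.eq_zero {D : BoundedBorel E} {Z : E → Lp ℂ 2 P} {Y : Lp ℂ 2 P}
    (h : HasStochIntegralOn Z M₁ D Y) (hZ : ∀ x ∈ D.toSet, Z x = 0) : Y = 0 := by
  refine h.unique ⟨h.nonempty, fun R => ?_⟩
  have h_zero : ∀ n, (fun ω => R.sum Z M₁ n ω - (0 : Lp ℂ 2 P) ω) =ᵐ[P] 0 := by
    intro n
    have h_sum : ∀ ω, (∀ j, Z (R.tag n j) ω = 0) → R.sum Z M₁ n ω = 0 := fun ω hω =>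
      Finset.sum_eq_zero fun j _ => by rw [hω j, zero_mul]
    have h_tag : ∀ᵐ ω ∂P, ∀ j, Z (R.tag n j) ω = 0 := ae_all_iff.mpr fun j => by
      rw [hZ _ (R.cell_subset n j (R.tag_mem n j))]
      exact Lp.coeFn_zero ℂ 2 P
    filter_upwards [h_tag, Lp.coeFn_zero ℂ 2 P] with ω hω h0
    rw [h_sum ω hω, h0, Pi.zero_apply, sub_zero]
  simp only [fun n => eLpNorm_congr_ae (p := 2) (h_zero n), eLpNorm_zero]
  exact tendsto_const_nhds

namespace IsTensorRandomMeasure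

theorem integral_indicator_snd (hT : IsTensorRandomMeasure P M₁ M₂ T) {φ : E → ℂ}
    {B : BoundedBorel F} {Z W : Lp ℂ 2 P} (hZ : HasIntegral M₁ φ Z)
    (hW : HasIntegral T ((Prod.snd ⁻¹' B.toSet).indicator (φ ∘ Prod.fst)) W) :
    W =ᵐ[P] fun ω => Z ω * (M₂ B ω : ℂ) := by
  obtain ⟨s, hs⟩ := hZ.exists_approx
  refine ae_eq_mul_of_tendsto_Lp (hZ.tendsto s hs)
    (hW.tendsto _ (hs.map (isPullbackOn_prod_right B))) fun n => ?_
  have h_prod : ∀ᵐ ω ∂P, ∀ i, T (((s n).set i).prod B) ω = M₁ ((s n).set i) ω * M₂ B ω :=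
    ae_all_iff.mpr fun i => hT.apply_prod _ _
  rw [SimpleFn.integral_map]
  filter_upwards [(s n).coeFn_integral M₁, (s n).coeFn_integral (T ∘ fun A => A.prod B), h_prod]
    with ω h₁ h h_prod
  rw [h, h₁, Finset.sum_mul]
  refine Finset.sum_congr rfl fun i _ => ?_
  rw [Function.comp_apply, h_prod i, Complex.ofReal_mul, mul_assoc]

theorem exists_hasIntegral_eq_riemannSum [IsProbabilityMeasure P] [OpensMeasurableSpace (E × F)]
    (hT : IsTensorRandomMeasure P M₁ M₂ T) {ψ : E × F → ℂ} {Z : F → Lp ℂ 2 P}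
    (hZ : ∀ y, HasIntegral M₁ (fun x => ψ (x, y)) (Z y)) {D : BoundedBorel F}
    (R : RiemannSystem D) (n : ℕ) :
    ∃ W, HasIntegral T (fun z => (R.stepFn (fun y => ψ (z.1, y)) n).eval z.2) W ∧
      W =ᵐ[P] R.sum Z M₂ n := by
  have hTb := hT.isRandomMeasure.boundedSemivariation
  have h_cell : ∀ j, ∃ W, HasIntegral T ((Prod.snd ⁻¹' (R.cell n j).toSet).indicator
      ((fun x => ψ (x, R.tag n j)) ∘ Prod.fst)) W := fun j => by
    obtain ⟨s, hs⟩ := (hZ (R.tag n j)).exists_approx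
    exact (hs.map (isPullbackOn_prod_right (R.cell n j))).exists_hasIntegral hTb
  choose W hW using h_cell
  refine ⟨∑ j, W j, ?_, ?_⟩
  · have h_sum := HasIntegral.finset_sum Finset.univ (fun j _ => hW j) hTb
    refine (congrArg (HasIntegral T · _) (funext fun z => ?_)).mp h_sum
    exact Finset.sum_apply z _ _
  · filter_upwards [Lp.coeFn_fun_finsetSum Finset.univ W,
      ae_all_iff.mpr fun j => hT.integral_indicator_snd (hZ _) (hW j)] with ω h_sum hω
    rw [h_sum]
    exact Finset.sum_congr rfl fun j _ => hω j

theorem hasStochIntegralOn [IsProbabilityMeasure P] [OpensMeasurableSpace (E × F)]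
    (hT : IsTensorRandomMeasure P M₁ M₂ T) {ψ : E × F → ℂ} (hψ : UniformContinuous ψ)
    {A : BoundedBorel E} (hψA : ∀ x ∉ A.toSet, ∀ y, ψ (x, y) = 0) {Z : F → Lp ℂ 2 P}
    (hZ : ∀ y, HasIntegral M₁ (fun x => ψ (x, y)) (Z y)) {D : BoundedBorel F}
    (hD : Nonempty (RiemannSystem D)) {Y : Lp ℂ 2 P}
    (hY : HasIntegral T ((Prod.snd ⁻¹' D.toSet).indicator ψ) Y) : HasStochIntegralOn Z M₂ D Y := by
  refine ⟨hD, fun R => ?_⟩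
  have hTb := hT.isRandomMeasure.boundedSemivariation
  choose W hW hW_eq using hT.exists_hasIntegral_eq_riemannSum hZ R
  have h_equi : UniformEquicontinuous fun x y => ψ (x, y) := by
    rw [Metric.uniformEquicontinuous_iff]
    intro ε hε
    obtain ⟨δ, hδ, h⟩ := Metric.uniformContinuous_iff.mp hψ ε hε
    exact ⟨δ, hδ, fun y y' hy x => h ((dist_prod_same_left ..).trans_lt hy)⟩
  have h_lim : Tendsto W atTop (𝓝 Y) := by
    refine HasIntegral.tendsto_of_tendstoUniformly hW hY hTb (D := A.prod D) (fun n z hz => ?_)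
      (R.tendstoUniformly_eval_stepFn h_equi)
    by_cases hy : z.2 ∈ D.toSet
    · have hψz : ∀ y, ψ (z.1, y) = 0 := hψA z.1 fun hx => hz ⟨hx, hy⟩
      simp only [RiemannSystem.stepFn, SimpleFn.eval, hψz, Set.indicator_zero,
        Finset.sum_const_zero]
      exact (Set.indicator_apply_eq_zero.mpr fun _ => hψz z.2).symm
    · rw [R.eval_stepFn_of_notMem _ _ hy]
      exact (Set.indicator_of_notMem (s := Prod.snd ⁻¹' D.toSet) hy ψ).symm
  refine ((Lp.tendsto_Lp_iff_tendsto_eLpNorm' W Y).mp h_lim).congr fun n => eLpNorm_congr_ae ?_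
  filter_upwards [hW_eq n] with ω hω
  rw [Pi.sub_apply, hω]

theorem hasStochIntegral [IsProbabilityMeasure P] [ProperSpace F] [OpensMeasurableSpace E]
    [OpensMeasurableSpace F] (hT : IsTensorRandomMeasure P M₁ M₂ T)
    (hM₁ : BoundedSemivariation M₁) {ψ : E × F → ℂ} (hψ : Continuous ψ)
    (hc : HasCompactSupport ψ) {Z : F → Lp ℂ 2 P}
    (hZ : ∀ y, HasIntegral M₁ (fun x => ψ (x, y)) (Z y)) {X : Lp ℂ 2 P}
    (hX : HasIntegral T ψ X) : HasStochIntegral Z M₂ X := by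
  have hTb := hT.isRandomMeasure.boundedSemivariation
  have hψu := hc.uniformContinuous_of_continuous hψ
  obtain ⟨A, B, hψA, hψB⟩ := exists_boundedBorel_forall_eq_zero hc
  refine ⟨fun y => (HasIntegral.continuous_of_uniformContinuous hM₁ hψu hψA hZ).tendsto y,
    ⟨B, fun y hy => ?_⟩, fun D hD => ?_⟩
  · have hψy : (fun x => ψ (x, y)) = 0 := funext fun x => hψB x y hy
    exact (hψy ▸ hZ y).unique (HasIntegral.zero hM₁)
  let D' : BoundedBorel F := B.trace D.toSetᶜ D.measurableSet.compl
  obtain ⟨Y, hY⟩ := hX.exists_indicator (measurable_snd D.measurableSet) hTb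
  obtain ⟨Y', hY'⟩ := hX.exists_indicator (measurable_snd D'.measurableSet) hTb
  have hY'_zero : Y' = 0 := (hT.hasStochIntegralOn hψu hψA hZ inferInstance hY').eq_zero
    fun y hy => hD y hy.1
  have hψ_split : (Prod.snd ⁻¹' D.toSet).indicator ψ +
      (Prod.snd ⁻¹' D'.toSet).indicator ψ = ψ := by
    have h_disj : Disjoint D.toSet D'.toSet := Set.disjoint_left.mpr fun y hy hy' => hy'.1 hy
    refine (Set.indicator_union_of_disjoint (h_disj.preimage Prod.snd) ψ).symm.trans
      (Set.indicator_eq_self.mpr fun z hz => ?_)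
    exact (em (z.2 ∈ D.toSet)).imp_right fun h => ⟨h, by_contra fun h => hz (hψB z.1 z.2 h)⟩
  have hXY : X = Y := by
    rw [← add_zero Y, ← hY'_zero]
    exact hX.unique (hψ_split ▸ hY.add hY' hTb)
  exact hXY ▸ hT.hasStochIntegralOn hψu hψA hZ inferInstance hY

end IsTensorRandomMeasure

end Iterated

/-! ### Exchanging the two factors -/

theorem isometry_prodSwap {E F : Type*} [PseudoMetricSpace E] [PseudoMetricSpace F] :
    Isometry (Prod.swap : E × F → F × E) :=
  Isometry.of_dist_eq fun _ _ => max_comm _ _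

section Swap

variable {E F : Type*} [MeasurableSpace E] [PseudoMetricSpace E] [MeasurableSpace F]
  [PseudoMetricSpace F] {Ω : Type*} [MeasurableSpace Ω] {P : Measure Ω}

/-- The image of a bounded Borel set of a product under the exchange of the two factors. -/
def BoundedBorel.swap (U : BoundedBorel (E × F)) : BoundedBorel (F × E) :=
  U.preimage Prod.swap measurable_swap isometry_prodSwap.antilipschitz

theorem isPullbackOn_swap :
    IsPullbackOn Set.univ Prod.swap (BoundedBorel.swap : BoundedBorel (E × F) → _) :=
  isPullbackOn_preimage measurable_swap isometry_prodSwap.antilipschitz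

theorem BoundedBorel.swap_prod (A : BoundedBorel E) (B : BoundedBorel F) :
    (A.prod B).swap = B.prod A :=
  BoundedBorel.ext (Set.preimage_swap_prod _ _)

theorem IsRandomMeasure.comp_preimage {M : BoundedBorel E → Lp ℝ 2 P}
    (hM : IsRandomMeasure P M) {g : E → F} (hg : Measurable g) (hgi : Isometry g) :
    IsRandomMeasure P (M ∘ BoundedBorel.preimage g hg hgi.antilipschitz) where
  sigmaAdditive := hM.sigmaAdditive.comp (isPullbackOn_preimage hg hgi.antilipschitz)
  exists_covariance := by
    obtain ⟨C, hC, hCM⟩ := hM.exists_covariance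
    have hgg : AntilipschitzWith 1 (Prod.map g g) := (hgi.prodMap hgi).antilipschitz
    refine ⟨_, hC.comp (isPullbackOn_preimage (hg.prodMap hg) hgg), fun A B => ?_⟩
    exact hCM (A.preimage g hg hgi.antilipschitz) (B.preimage g hg hgi.antilipschitz)

variable {M₁ : BoundedBorel E → Lp ℝ 2 P} {M₂ : BoundedBorel F → Lp ℝ 2 P}
  {T : BoundedBorel (E × F) → Lp ℝ 2 P}

theorem IsTensorRandomMeasure.swap (hT : IsTensorRandomMeasure P M₁ M₂ T) :
    IsTensorRandomMeasure P M₂ M₁ (T ∘ BoundedBorel.swap) where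
  isRandomMeasure := hT.isRandomMeasure.comp_preimage measurable_swap isometry_prodSwap
  apply_prod B A := by
    filter_upwards [hT.apply_prod A B] with ω hω
    rw [Function.comp_apply, BoundedBorel.swap_prod, hω, mul_comm]

theorem HasIntegral.swap {ψ : E × F → ℂ} {X : Lp ℂ 2 P} (h : HasIntegral T ψ X)
    (hT : BoundedSemivariation T) :
    HasIntegral (T ∘ BoundedBorel.swap) (ψ ∘ Prod.swap) X := by
  have h_map := HasIntegral.map (M := T ∘ BoundedBorel.swap) (f := BoundedBorel.swap) h
    isPullbackOn_swap (hT.comp isPullbackOn_swap)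
  rwa [Set.indicator_univ] at h_map

end Swap

section Slices

variable {E F : Type*} [MeasurableSpace E] [PseudoMetricSpace E] [OpensMeasurableSpace E]
  {Ω : Type*} [MeasurableSpace Ω] {P : Measure Ω} {M : BoundedBorel E → Lp ℝ 2 P}

theorem BoundedSemivariation.exists_hasIntegral (hM : BoundedSemivariation M) {φ : E → ℂ}
    (hφ : Continuous φ) (hc : HasCompactSupport φ) : ∃ X, HasIntegral M φ X := by
  obtain ⟨s, hs⟩ := exists_approximates_of_hasCompactSupport hφ hc
  exact hs.exists_hasIntegral hM

theorem BoundedSemivariation.exists_hasIntegral_slice {F : Type*} [PseudoMetricSpace F]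
    (hM : BoundedSemivariation M) {ψ : E × F → ℂ} (hψ : Continuous ψ)
    (hc : HasCompactSupport ψ) :
    ∃ Z : F → Lp ℂ 2 P, ∀ y, HasIntegral M (fun x => ψ (x, y)) (Z y) := by
  have h_slice : ∀ y, HasCompactSupport fun x => ψ (x, y) := fun y =>
    HasCompactSupport.of_support_subset_isCompact (hc.isCompact.image continuous_fst)
      fun x hx => ⟨(x, y), subset_tsupport ψ hx, rfl⟩
  choose Z hZ using fun y =>
    hM.exists_hasIntegral (hψ.comp (Continuous.prodMk_left y)) (h_slice y)
  exact ⟨Z, hZ⟩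

end Slices

end

end RandomMeasures

theorem mainTheorem7_general {Ω E F : Type*} [MeasurableSpace Ω] [MeasurableSpace E]
    [PseudoMetricSpace E] [ProperSpace E] [OpensMeasurableSpace E] [MeasurableSpace F]
    [PseudoMetricSpace F] [ProperSpace F] [OpensMeasurableSpace F] (P : Measure Ω)
    [IsProbabilityMeasure P] (M₁ : BoundedBorel E → Lp ℝ 2 P) (M₂ : BoundedBorel F → Lp ℝ 2 P)
    (hM₁ : IsRandomMeasure P M₁) (hM₂ : IsRandomMeasure P M₂)
    (hG : JointlyGaussian P M₁ M₂) (hC : HasCrossCovarianceMeasure P M₁ M₂) :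
    ∃ T : BoundedBorel (E × F) → Lp ℝ 2 P,
      IsTensorRandomMeasure P M₁ M₂ T ∧ (∀ T', IsTensorRandomMeasure P M₁ M₂ T' → T' = T) ∧
      ∀ ψ : E × F → ℂ, Continuous ψ → HasCompactSupport ψ →
        ∃ (Z₁ : F → Lp ℂ 2 P) (Z₂ : E → Lp ℂ 2 P) (X : Lp ℂ 2 P),
          (∀ y, HasIntegral M₁ (fun x => ψ (x, y)) (Z₁ y)) ∧
          (∀ x, HasIntegral M₂ (fun y => ψ (x, y)) (Z₂ x)) ∧
          HasIntegral T ψ X ∧ HasStochIntegral Z₁ M₂ X ∧ HasStochIntegral Z₂ M₁ X := by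
  obtain ⟨T, hT⟩ := hG.exists_isTensorRandomMeasure hM₁ hM₂ hC
  refine ⟨T, hT, fun T' hT' => hT'.unique hT, fun ψ hψ hc => ?_⟩
  have hM₁b := hM₁.boundedSemivariation
  have hM₂b := hM₂.boundedSemivariation
  have hTb := hT.isRandomMeasure.boundedSemivariation
  have hψ' : Continuous (ψ ∘ Prod.swap) := hψ.comp continuous_swap
  have hc' : HasCompactSupport (ψ ∘ Prod.swap) := hc.comp_homeomorph (Homeomorph.prodComm F E)
  obtain ⟨Z₁, hZ₁⟩ := hM₁b.exists_hasIntegral_slice hψ hc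
  obtain ⟨Z₂, hZ₂⟩ := hM₂b.exists_hasIntegral_slice hψ' hc'
  obtain ⟨X, hX⟩ := hTb.exists_hasIntegral hψ hc
  exact ⟨Z₁, Z₂, X, hZ₁, hZ₂, hX, hT.hasStochIntegral hM₁b hψ hc hZ₁ hX,
    hT.swap.hasStochIntegral hM₂b hψ' hc' hZ₂ (hX.swap hTb)⟩

theorem mainTheorem7 {Ω : Type*} [MeasurableSpace Ω] (P : Measure Ω) [IsProbabilityMeasure P]
    (d p : ℕ)
    (M₁ : BoundedBorel (EuclideanSpace ℝ (Fin d)) → Lp ℝ 2 P)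
    (M₂ : BoundedBorel (EuclideanSpace ℝ (Fin p)) → Lp ℝ 2 P)
    (hM₁ : IsRandomMeasure P M₁) (hM₂ : IsRandomMeasure P M₂)
    (hG : JointlyGaussian P M₁ M₂) (hC : HasCrossCovarianceMeasure P M₁ M₂) :
    ∃ T : BoundedBorel (EuclideanSpace ℝ (Fin d) × EuclideanSpace ℝ (Fin p)) → Lp ℝ 2 P,
      -- `T` is the tensor product `M₁ ⊗ M₂`
      IsTensorRandomMeasure P M₁ M₂ T ∧ (∀ T', IsTensorRandomMeasure P M₁ M₂ T' → T' = T) ∧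
      ∀ ψ : EuclideanSpace ℝ (Fin d) × EuclideanSpace ℝ (Fin p) → ℂ,
        Continuous ψ → HasCompactSupport ψ →
        ∃ (Z₁ : EuclideanSpace ℝ (Fin p) → Lp ℂ 2 P) (Z₂ : EuclideanSpace ℝ (Fin d) → Lp ℂ 2 P)
          (X : Lp ℂ 2 P),
          (∀ y, HasIntegral M₁ (fun x => ψ (x, y)) (Z₁ y)) ∧
          (∀ x, HasIntegral M₂ (fun y => ψ (x, y)) (Z₂ x)) ∧
          HasIntegral T ψ X ∧
          HasStochIntegral Z₁ M₂ X ∧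
          HasStochIntegral Z₂ M₁ X := by
  exact mainTheorem7_general P M₁ M₂ hM₁ hM₂ hG hC
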